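/- A geometric graph on $n$ vertices is a simple graph whose vertices are $n$ distinct points in general position in the plane (no three on a line) and whose edges are the straight line segments joining adjacent vertices. Two distinct edges cross if their interiors intersect; let $\mathrm{crs}(G)$ be the number of unordered pairs of distinct edges of $G$ that cross. **Theorem.** There is an algorithm on the real RAM that, given any geometric graph $G$ on $n$ vertices, by the coordinates of its vertices and its adjacency matrix, computes $\mathrm{crs}(G)$ in $O(n^2 \log n)$ time in the worst case. Here the real RAM performs arithmetic operations $(+,-,\times,/)$ on and comparisons of real numbers, operations on and comparisons of integer words of $O(\log n)$ bits, and memory accesses (addressed by words), each at unit cost; it cannot round a real number or convert it to a word. -/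

import Mathlib

open Filter Asymptotics

/-! Geometric graphs and their crossings. -/

/-- A geometric graph on `n` vertices: a simple graph whose vertices are pairwise distinct points of
the Euclidean plane, no three of them on a line, and whose edges are the straight line segments
joining adjacent vertices. -/
structure GeometricGraph (n : ℕ) where
  point : Fin n → EuclideanSpace ℝ (Fin 2)
  graph : SimpleGraph (Fin n)
  point_injective : Function.Injective point
  not_collinear : ∀ i j k : Fin n, i ≠ j → i ≠ k → j ≠ k →
    ¬ Collinear ℝ {point i, point j, point k}

namespace GeometricGraph

variable {n : ℕ}

/-- The interior of the segment that represents the pair `e` of vertices. -/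
def edgeInterior (G : GeometricGraph n) (e : Sym2 (Fin n)) : Set (EuclideanSpace ℝ (Fin 2)) :=
  Sym2.lift ⟨fun u v => openSegment ℝ (G.point u) (G.point v),
    fun _ _ => openSegment_symm ℝ _ _⟩ e

/-- Two edges cross if they intersect in their interiors. -/
def Cross (G : GeometricGraph n) (e f : Sym2 (Fin n)) : Prop :=
  (G.edgeInterior e ∩ G.edgeInterior f).Nonempty

/-- The number of unordered pairs of distinct edges of `G` that cross. -/
noncomputable def crossings (G : GeometricGraph n) : ℕ :=
  Set.ncard {P : Sym2 (Sym2 (Fin n)) |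
    ∃ e ∈ G.graph.edgeSet, ∃ f ∈ G.graph.edgeSet, e ≠ f ∧ G.Cross e f ∧ P = s(e, f)}

end GeometricGraph

/-! The real RAM: a random access machine that stores words (natural numbers below a bound `W`) and
real numbers, in separate registers and arrays. Each arithmetic operation, comparison and memory
access takes one unit of time. Reals can be compared, but cannot be rounded or converted to words;
addresses are words. -/

namespace RealRAM

/-- A memory configuration. Registers and arrays are named by natural numbers. A fixed program
mentions finitely many of them. `wmem a k` and `rmem a k` are the entries with index `k` of the
word array and the real array named `a`. -/
structure State where
  wreg : ℕ → ℕ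
  rreg : ℕ → ℝ
  wmem : ℕ → ℕ → ℕ
  rmem : ℕ → ℕ → ℝ

/-- Word operations; subtraction is truncated at `0`, division is rounded down. -/
inductive WordOp where
  | add | sub | mul | div

/-- Real operations. -/
inductive RealOp where
  | add | sub | mul | div

/-- The value of a word operation; division by zero is undefined. -/
def WordOp.eval : WordOp → ℕ → ℕ → Option ℕ
  | .add, x, y => some (x + y)
  | .sub, x, y => some (x - y)
  | .mul, x, y => some (x * y)
  | .div, x, y => if y = 0 then none else some (x / y)

open Classical in
/-- The value of a real operation; division by zero is undefined. -/
noncomputable def RealOp.eval : RealOp → ℝ → ℝ → Option ℝ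
  | .add, x, y => some (x + y)
  | .sub, x, y => some (x - y)
  | .mul, x, y => some (x * y)
  | .div, x, y => if y = 0 then none else some (x / y)

/-- Elementary instructions. The operands `d`, `i`, `j`, `r` are names of registers and `a` is the
name of an array. -/
inductive Instr where
  /-- word register `d` := the constant `k` -/
  | wconst (d k : ℕ)
  /-- word register `d` := word register `i` op word register `j` -/
  | wop (op : WordOp) (d i j : ℕ)
  /-- word register `d` := `a[i]`, the index being the content of word register `i` -/
  | wload (d a i : ℕ)
  /-- `a[i]` := word register `r`, the index being the content of word register `i` -/
  | wstore (a i r : ℕ)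
  /-- real register `d` := the content of word register `i`, as a real number -/
  | rcast (d i : ℕ)
  /-- real register `d` := real register `i` op real register `j` -/
  | rop (op : RealOp) (d i j : ℕ)
  /-- real register `d` := `a[i]`, the index being the content of word register `i` -/
  | rload (d a i : ℕ)
  /-- `a[i]` := real register `r`, the index being the content of word register `i` -/
  | rstore (a i r : ℕ)

/-- Write the word `v` to register `d`; this fails if `v` does not fit into a word. -/
def State.setWord (W : ℕ) (s : State) (d v : ℕ) : Option State :=
  if v < W then some { s with wreg := Function.update s.wreg d v } else none

/-- Write the real number `v` to register `d`. -/
def State.setReal (s : State) (d : ℕ) (v : ℝ) : State :=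
  { s with rreg := Function.update s.rreg d v }

/-- The effect of an instruction on a machine with words below `W`; `none` means that the machine
gets stuck (overflow or division by zero), and then the run never ends. -/
noncomputable def Instr.exec (W : ℕ) (s : State) : Instr → Option State
  | .wconst d k => s.setWord W d k
  | .wop op d i j => (op.eval (s.wreg i) (s.wreg j)).bind (s.setWord W d)
  | .wload d a i => s.setWord W d (s.wmem a (s.wreg i))
  | .wstore a i r => some { s with
      wmem := Function.update s.wmem a (Function.update (s.wmem a) (s.wreg i) (s.wreg r)) }
  | .rcast d i => some (s.setReal d (s.wreg i))
  | .rop op d i j => (op.eval (s.rreg i) (s.rreg j)).map (s.setReal d)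
  | .rload d a i => some (s.setReal d (s.rmem a (s.wreg i)))
  | .rstore a i r => some { s with
      rmem := Function.update s.rmem a (Function.update (s.rmem a) (s.wreg i) (s.rreg r)) }

/-- Tests: comparisons of two word registers or of two real registers. -/
inductive Test where
  | wlt (i j : ℕ)
  | weq (i j : ℕ)
  | rlt (i j : ℕ)
  | req (i j : ℕ)

/-- The test succeeds in the given state. -/
def Test.Holds (s : State) : Test → Prop
  | .wlt i j => s.wreg i < s.wreg j
  | .weq i j => s.wreg i = s.wreg j
  | .rlt i j => s.rreg i < s.rreg j
  | .req i j => s.rreg i = s.rreg j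

/-- Programs. -/
inductive Program where
  | skip
  | instr (c : Instr)
  | seq (p q : Program)
  | ifThenElse (b : Test) (p q : Program)
  | whileDo (b : Test) (p : Program)

/-- `Runs W p s t s'`: on a machine with words below `W`, the program `p` started in state `s`
halts after exactly `t` units of time in state `s'`. Every instruction and every evaluation of a
test takes one unit. -/
inductive Runs (W : ℕ) : Program → State → ℕ → State → Prop where
  | skip (s : State) : Runs W .skip s 0 s
  | instr {c : Instr} {s s' : State} (h : c.exec W s = some s') : Runs W (.instr c) s 1 s'
  | seq {p q : Program} {s s' s'' : State} {t t' : ℕ}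
      (h : Runs W p s t s') (h' : Runs W q s' t' s'') : Runs W (.seq p q) s (t + t') s''
  | ifTrue {b : Test} {p q : Program} {s s' : State} {t : ℕ}
      (hb : b.Holds s) (h : Runs W p s t s') : Runs W (.ifThenElse b p q) s (t + 1) s'
  | ifFalse {b : Test} {p q : Program} {s s' : State} {t : ℕ}
      (hb : ¬ b.Holds s) (h : Runs W q s t s') : Runs W (.ifThenElse b p q) s (t + 1) s'
  | whileTrue {b : Test} {p : Program} {s s' s'' : State} {t t' : ℕ}
      (hb : b.Holds s) (h : Runs W p s t s') (h' : Runs W (.whileDo b p) s' t' s'') :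
      Runs W (.whileDo b p) s (t + t' + 1) s''
  | whileFalse {b : Test} {p : Program} {s : State}
      (hb : ¬ b.Holds s) : Runs W (.whileDo b p) s 1 s

open Classical in
/-- The initial state on input `G`: word register `0` holds `n`, word array `0` holds the adjacency
matrix of `G` row by row, real arrays `0` and `1` hold the two lists of coordinates of the vertices;
everything else is `0`. -/
noncomputable def input {n : ℕ} (G : GeometricGraph n) : State where
  wreg := fun i => if i = 0 then n else 0
  rreg := fun _ => 0
  wmem := fun a k =>
    if a = 0 ∧ ∃ i j : Fin n, k = (i : ℕ) * n + (j : ℕ) ∧ G.graph.Adj i j then 1 else 0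
  rmem := fun a k =>
    if h : k < n then
      if a = 0 then G.point ⟨k, h⟩ 0 else if a = 1 then G.point ⟨k, h⟩ 1 else 0
    else 0

end RealRAM

/-! Crossings are recovered from counts attached to lines through two vertices. For distinct
vertices v, w, let D(v,w) be the number of neighbours of v above the line vw minus the number below
it. Then D(v,w) * D(w,v) is a sum over edges vu and wx, with +1 if u and x lie on the same side of
the line vw, -1 if they lie on opposite sides, and 0 if one of them lies on the line.

Take two edges without a common endpoint. Four lines join an endpoint of one to an endpoint of the
other. If the edges cross, they are the diagonals of a convex quadrilateral, and the other two
endpoints are on the same side of each of the four lines: the total is 4. Otherwise the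
contributions cancel, whether or not the four points are in convex position
(`sum_side_of_distinct`). Summation over all ordered pairs (v,w) counts each crossing 8 times. The
only other contribution comes from two edges vu and wu at a common vertex u, trivially on the same
side of vw; it amounts to the sum of deg(u) * (deg(u) - 1). This gives `sum_signed_counts`, from
which the number of crossings is read off by a subtraction and a division by 8.

All D(v,w) for a fixed v come from rotating a line about v. Every vector from v is reflected into
the right half plane and the lines are sorted by slope. A neighbour to the right of v is above the
rotating line until the line passes it, and below afterwards; for a neighbour to the left it is the
reverse. One sort and one sweep per vertex take O(n log n) time, and the final sum over pairs takes
O(n^2).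

The verification keeps the machine apart from the geometry: `countCrossings_spec` describes the
output for abstract arrays, and `nbrsAbove_sub_nbrsBelow` and `sum_samePairs` identify it with the
geometric count. -/

namespace GeometricGraph

variable {n : ℕ}

/-! ### Orientations and crossing segments. -/

/-- Twice the signed area of the triangle spanned by three vertices. -/
noncomputable def orient (G : GeometricGraph n) (i j k : Fin n) : ℝ :=
  (G.point j 0 - G.point i 0) * (G.point k 1 - G.point i 1) -
    (G.point j 1 - G.point i 1) * (G.point k 0 - G.point i 0)

theorem orient_ne_zero (G : GeometricGraph n) {i j k : Fin n} (hij : i ≠ j) (hik : i ≠ k)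
    (hjk : j ≠ k) : G.orient i j k ≠ 0 := by
  intro h0
  refine G.not_collinear i j k hij hik hjk ?_
  rw [collinear_iff_of_mem (p₀ := G.point i) (by simp)]
  refine ⟨G.point j - G.point i, ?_⟩
  have hp : G.point j ≠ G.point i := fun h => hij (G.point_injective h).symm
  unfold orient at h0
  rintro p (rfl | rfl | rfl)
  · exact ⟨0, by simp⟩
  · exact ⟨1, by simp⟩
  -- A nonzero coordinate of the direction determines the parameter on the line; the vanishing
  -- determinant then settles the other coordinate.
  · by_cases hx : G.point j 0 - G.point i 0 = 0
    · have hy : G.point j 1 - G.point i 1 ≠ 0 := by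
        intro hy
        apply hp
        ext a
        fin_cases a
        · simpa using sub_eq_zero.mp hx
        · simpa using sub_eq_zero.mp hy
      refine ⟨(G.point k 1 - G.point i 1) / (G.point j 1 - G.point i 1), ?_⟩
      have hk : G.point k 0 - G.point i 0 = 0 := by
        have : (G.point j 1 - G.point i 1) * (G.point k 0 - G.point i 0) = 0 := by
          rw [hx] at h0; linarith
        exact (mul_eq_zero.mp this).resolve_left hy
      ext a
      fin_cases a
      · simp [hx]; linarith
      · simp; field_simp; ring
    · refine ⟨(G.point k 0 - G.point i 0) / (G.point j 0 - G.point i 0), ?_⟩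
      ext a
      fin_cases a
      · simp; field_simp; ring
      · simp; field_simp; linarith

/-- The coordinates of a common point of two open segments. -/
theorem openSegment_inter_nonempty_iff (a b c d : EuclideanSpace ℝ (Fin 2)) :
    (openSegment ℝ a b ∩ openSegment ℝ c d).Nonempty ↔
      ∃ s t : ℝ, 0 < s ∧ s < 1 ∧ 0 < t ∧ t < 1 ∧
        ∀ i, a i + s * (b i - a i) = c i + t * (d i - c i) := by
  simp only [openSegment_eq_image', Set.Nonempty, Set.mem_inter_iff, Set.mem_image, Set.mem_Ioo]
  constructor
  · rintro ⟨p, ⟨s, ⟨hs0, hs1⟩, rfl⟩, ⟨t, ⟨ht0, ht1⟩, h⟩⟩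
    refine ⟨s, t, hs0, hs1, ht0, ht1, fun i => ?_⟩
    have := congrArg (fun q : EuclideanSpace ℝ (Fin 2) => q i) h
    simpa using this.symm
  · rintro ⟨s, t, hs0, hs1, ht0, ht1, h⟩
    refine ⟨_, ⟨s, ⟨hs0, hs1⟩, rfl⟩, ⟨t, ⟨ht0, ht1⟩, ?_⟩⟩
    ext i
    simpa using (h i).symm

theorem mul_neg_of_combination_eq_zero {t a b : ℝ} (h0 : 0 < t) (h1 : t < 1) (ha : a ≠ 0)
    (h : (1 - t) * a + t * b = 0) : a * b < 0 := by
  have : t * (a * b) = -((1 - t) * (a * a)) := by linear_combination a * h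
  have h2 : 0 < (1 - t) * (a * a) := mul_pos (by linarith) (mul_self_pos.mpr ha)
  by_contra hc
  have := mul_nonneg h0.le (not_lt.mp hc)
  linarith

theorem div_sub_mem_Ioo {a b : ℝ} (h : a * b < 0) : a / (a - b) ∈ Set.Ioo (0 : ℝ) 1 := by
  rcases mul_neg_iff.mp h with ⟨ha, hb⟩ | ⟨ha, hb⟩
  · exact ⟨div_pos ha (by linarith), (div_lt_one (by linarith)).mpr (by linarith)⟩
  · exact ⟨div_pos_of_neg_of_neg ha (by linarith),
      (div_lt_one_of_neg (by linarith)).mpr (by linarith)⟩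

/-- The orientation against a fixed line is an affine function of the third point. Along the segment
from w to x it vanishes at a common point with the other segment, so it has opposite signs at the
two ends, and likewise with the roles exchanged. Conversely, the zeros of the two affine functions
give the parameters s and t. -/
theorem cross_mk_iff (G : GeometricGraph n) {v u w x : Fin n} (hvu : v ≠ u) (hvw : v ≠ w)
    (hvx : v ≠ x) (huw : u ≠ w) (hux : u ≠ x) (hwx : w ≠ x) :
    G.Cross s(v, u) s(w, x) ↔
      G.orient v u w * G.orient v u x < 0 ∧ G.orient v w x * G.orient u w x < 0 := by
  have h1 := G.orient_ne_zero huw hux hwx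
  have h2 := G.orient_ne_zero hvw hvx hwx
  have h3 := G.orient_ne_zero hvu hvx hux
  have h4 := G.orient_ne_zero hvu hvw huw
  have key : (G.Cross s(v, u) s(w, x)) ↔ _ :=
    openSegment_inter_nonempty_iff (G.point v) (G.point u) (G.point w) (G.point x)
  simp only [key, Fin.forall_fin_two]
  constructor
  · rintro ⟨s, t, hs0, hs1, ht0, ht1, hX, hY⟩
    have e1 : (1 - t) * G.orient v u w + t * G.orient v u x = 0 := by
      unfold orient; linear_combination (G.point u 1 - G.point v 1) * hX -
        (G.point u 0 - G.point v 0) * hY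
    have e2 : (1 - s) * G.orient v w x + s * G.orient u w x = 0 := by
      unfold orient; linear_combination (G.point x 0 - G.point w 0) * hY -
        (G.point x 1 - G.point w 1) * hX
    exact ⟨mul_neg_of_combination_eq_zero ht0 ht1 h4 e1,
      mul_neg_of_combination_eq_zero hs0 hs1 h2 e2⟩
  · rintro ⟨n1, n2⟩
    -- This affine dependence of four points makes the two denominators negatives of each other, so
    -- that both parameters describe the same point.
    have hd : G.orient v w x - G.orient u w x = G.orient v u x - G.orient v u w := by
      unfold orient; ring
    have d1 : G.orient v u w - G.orient v u x ≠ 0 := by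
      intro h; rw [sub_eq_zero.mp h] at n1; nlinarith
    have d2 : G.orient v w x - G.orient u w x ≠ 0 := by
      intro h; rw [sub_eq_zero.mp h] at n2; nlinarith
    refine ⟨G.orient v w x / (G.orient v w x - G.orient u w x),
      G.orient v u w / (G.orient v u w - G.orient v u x), ?_, ?_, ?_, ?_, ?_, ?_⟩
    · exact (div_sub_mem_Ioo n2).1
    · exact (div_sub_mem_Ioo n2).2
    · exact (div_sub_mem_Ioo n1).1
    · exact (div_sub_mem_Ioo n1).2
    · rw [div_mul_eq_mul_div, div_mul_eq_mul_div, ← sub_eq_zero]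
      have : G.orient v w x - G.orient u w x = -(G.orient v u w - G.orient v u x) := by
        rw [hd]; ring
      rw [this]
      field_simp
      unfold orient; ring
    · rw [div_mul_eq_mul_div, div_mul_eq_mul_div, ← sub_eq_zero]
      have : G.orient v w x - G.orient u w x = -(G.orient v u w - G.orient v u x) := by
        rw [hd]; ring
      rw [this]
      field_simp
      unfold orient; ring

theorem not_cross_of_common (G : GeometricGraph n) {v u x : Fin n} (hvu : v ≠ u)
    (hvx : v ≠ x) (hux : u ≠ x) : ¬ G.Cross s(v, u) s(v, x) := by
  have key : (G.Cross s(v, u) s(v, x)) ↔ _ :=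
    openSegment_inter_nonempty_iff (G.point v) (G.point u) (G.point v) (G.point x)
  simp only [key, Fin.forall_fin_two]
  rintro ⟨s, t, hs0, hs1, ht0, ht1, hX, hY⟩
  have e1 : t * G.orient v u x = 0 := by
    unfold orient; linear_combination (G.point u 1 - G.point v 1) * hX -
      (G.point u 0 - G.point v 0) * hY
  exact (mul_ne_zero ht0.ne' (G.orient_ne_zero hvu hvx hux)) e1

@[simp] theorem orient_left (G : GeometricGraph n) (i k : Fin n) : G.orient i i k = 0 := by
  simp [orient]

@[simp] theorem orient_outer (G : GeometricGraph n) (i j : Fin n) : G.orient i j i = 0 := by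
  simp [orient]

@[simp] theorem orient_right (G : GeometricGraph n) (i j : Fin n) : G.orient i j j = 0 := by
  simp [orient]; ring

theorem orient_swap_left (G : GeometricGraph n) (i j k : Fin n) :
    G.orient j i k = - G.orient i j k := by
  simp [orient]; ring

theorem orient_swap_right (G : GeometricGraph n) (i j k : Fin n) :
    G.orient i k j = - G.orient i j k := by
  simp [orient]; ring

theorem cross_comm (G : GeometricGraph n) (e f : Sym2 (Fin n)) : G.Cross e f ↔ G.Cross f e := by
  simp [Cross, Set.inter_comm]

/-! ### Side counts for a pair of edges. -/

/-- The sign of the orientation of a triple of vertices, as an integer. -/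
noncomputable def orientSign (G : GeometricGraph n) (i j k : Fin n) : ℤ :=
  (SignType.sign (G.orient i j k) : ℤ)

/-- Whether `u` and `x` lie on the same side (`1`) or on opposite sides (`-1`) of the line
through `v` and `w`. -/
noncomputable def side (G : GeometricGraph n) (v u w x : Fin n) : ℤ :=
  G.orientSign v w u * G.orientSign v w x

-- With s1, s2, s3, s4 the signs of the orientations of uwx, vwx, vux, vuw, the sum equals (s1 - s2)
-- * (s4 - s3). Without a crossing one factor is zero. With a crossing the product is 4 or -4, and
-- -4 is excluded because the orientations themselves satisfy D1 - D2 = D4 - D3. The proof checks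
-- all sign patterns.
open Classical in
theorem sum_side_of_distinct (G : GeometricGraph n) {v u w x : Fin n} (hvu : v ≠ u) (hvw : v ≠ w)
    (hvx : v ≠ x) (huw : u ≠ w) (hux : u ≠ x) (hwx : w ≠ x) :
    G.side v u w x + G.side u v w x + G.side v u x w + G.side u v x w =
      if G.Cross s(v, u) s(w, x) then 4 else 0 := by
  have h1 := G.orient_ne_zero huw hux hwx
  have h2 := G.orient_ne_zero hvw hvx hwx
  have h3 := G.orient_ne_zero hvu hvx hux
  have h4 := G.orient_ne_zero hvu hvw huw
  have hrel : G.orient u w x + G.orient v u x = G.orient v w x + G.orient v u w := by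
    unfold orient; ring
  rw [if_congr (G.cross_mk_iff hvu hvw hvx huw hux hwx) rfl rfl]
  unfold side orientSign
  rw [G.orient_swap_right v u w,
    show G.orient u w v = G.orient v u w by unfold orient; ring,
    G.orient_swap_right v u x, G.orient_swap_right v w x,
    show G.orient u x v = G.orient v u x by unfold orient; ring,
    G.orient_swap_right u w x]
  simp only [Left.sign_neg]
  revert h1 h2 h3 h4 hrel
  generalize G.orient u w x = D1
  generalize G.orient v w x = D2
  generalize G.orient v u x = D3
  generalize G.orient v u w = D4
  intro h1 h2 h3 h4 hrel
  rcases lt_or_gt_of_ne h1 with h1 | h1 <;> rcases lt_or_gt_of_ne h2 with h2 | h2 <;>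
  rcases lt_or_gt_of_ne h3 with h3 | h3 <;> rcases lt_or_gt_of_ne h4 with h4 | h4 <;>
  simp only [sign_neg, sign_pos, h1, h2, h3, h4, mul_neg_iff, not_lt_of_gt, and_true, and_false, or_false,
    false_or, if_true, if_false, and_self] <;>
  first | rfl | (exfalso; linarith)

-- Extends `sum_side_of_distinct` to edges with common endpoints. The conditionals drop the terms in
-- which the two far ends coincide, for these would contribute 1 without a crossing; the remaining
-- degenerate terms contain the orientation of a triple with a repeated vertex and vanish.
open Classical in
theorem sum_side (G : GeometricGraph n) {v u w x : Fin n} (hvu : v ≠ u) (hwx : w ≠ x) :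
    (if u = x then 0 else G.side v u w x) + (if v = x then 0 else G.side u v w x) +
      (if u = w then 0 else G.side v u x w) + (if v = w then 0 else G.side u v x w) =
      if s(v, u) ≠ s(w, x) ∧ G.Cross s(v, u) s(w, x) then 4 else 0 := by
  by_cases hvw : v = w
  · subst hvw
    by_cases hux : u = x
    · subst hux
      simp [side, orientSign]
    · simp [side, orientSign, G.not_cross_of_common hvu hwx hux]
  by_cases hux : u = x
  · subst hux
    have := G.not_cross_of_common hvu.symm hwx.symm hvw
    rw [Sym2.eq_swap, Sym2.eq_swap (a := u) (b := w)] at this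
    simp [side, orientSign, this]
  by_cases hvx : v = x
  · subst hvx
    by_cases huw : u = w
    · subst huw
      simp [side, orientSign, Sym2.eq_swap]
    · have := G.not_cross_of_common hvu hwx.symm huw
      rw [Sym2.eq_swap (a := v) (b := w)] at this
      simp [side, orientSign, this]
  by_cases huw : u = w
  · subst huw
    have := G.not_cross_of_common hvu.symm hwx hvx
    rw [Sym2.eq_swap (a := u) (b := v)] at this
    simp [side, orientSign, this]
  have hne : s(v, u) ≠ s(w, x) := by simp [hvw, hvx]
  simp only [if_neg hux, if_neg hvw, if_neg hvx, if_neg huw, hne, ne_eq, not_false_eq_true, true_and]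
  exact G.sum_side_of_distinct hvu hvw hvx huw hux hwx

/-! ### Double counting over pairs of oriented edges. -/

/-- The edges of a geometric graph, adjacent if they are distinct and cross. -/
def crossingGraph (G : GeometricGraph n) : SimpleGraph (Sym2 (Fin n)) where
  Adj e f := e ∈ G.graph.edgeSet ∧ f ∈ G.graph.edgeSet ∧ e ≠ f ∧ G.Cross e f
  symm := ⟨fun _ _ h => ⟨h.2.1, h.1, h.2.2.1.symm, (G.cross_comm _ _).1 h.2.2.2⟩⟩
  loopless := ⟨fun _ h => h.2.2.1 rfl⟩

-- Crossings are the edges of `crossingGraph`, so this is its handshake identity.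
open Classical in
theorem two_mul_crossings (G : GeometricGraph n) :
    (2 * G.crossings : ℤ) = ∑ e, ∑ f, if G.crossingGraph.Adj e f then 1 else 0 := by
  have h := G.crossingGraph.two_mul_card_edgeFinset
  have h2 : G.crossings = G.crossingGraph.edgeFinset.card := by
    rw [crossings, ← Set.ncard_coe_finset, SimpleGraph.coe_edgeFinset]
    congr 1
    ext P
    induction P with | _ e f =>
    simp only [Set.mem_ofPred_eq, SimpleGraph.mem_edgeSet]
    constructor
    · rintro ⟨e', he, f', hf, hne, hc, hP⟩
      rw [← SimpleGraph.mem_edgeSet, hP]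
      exact ⟨he, hf, hne, hc⟩
    · rintro ⟨he, hf, hne, hc⟩
      exact ⟨e, he, f, hf, hne, hc, rfl⟩
  rw [h2, ← Fintype.sum_prod_type', Finset.sum_boole]
  exact_mod_cast h

open Classical in
theorem sum_adj_mk (H : SimpleGraph (Fin n)) (F : Sym2 (Fin n) → ℤ) :
    ∑ v, ∑ u, (if H.Adj v u then F s(v, u) else 0) =
      2 * ∑ e, if e ∈ H.edgeSet then F e else 0 := by
  rw [← Fintype.sum_prod_type', ← Finset.sum_fiberwise (g := fun p : Fin n × Fin n => s(p.1, p.2)),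
    Finset.mul_sum]
  refine Finset.sum_congr rfl fun e _ => ?_
  induction e with | _ a b =>
  have : ∀ p ∈ Finset.univ.filter (fun p : Fin n × Fin n => s(p.1, p.2) = s(a, b)),
      (if H.Adj p.1 p.2 then F s(p.1, p.2) else 0) =
        if s(a, b) ∈ H.edgeSet then F s(a, b) else 0 := by
    intro p hp
    have hp' := (Finset.mem_filter.mp hp).2
    rw [hp']
    refine if_congr ?_ rfl rfl
    rw [← SimpleGraph.mem_edgeSet, hp']
  rw [Finset.sum_congr rfl this, Finset.sum_const]
  by_cases hab : H.Adj a b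
  · have hcard : (Finset.univ.filter (fun p : Fin n × Fin n => s(p.1, p.2) = s(a, b))) =
        {(a, b), (b, a)} := by
      ext ⟨c, d⟩
      simp
    rw [hcard, Finset.card_pair (by simp [hab.ne])]
    simp
  · simp [hab]

open Classical in
/-- Adjacency as an integer. -/
noncomputable def adjInt (G : GeometricGraph n) (v u : Fin n) : ℤ := if G.graph.Adj v u then 1 else 0

theorem adjInt_comm (G : GeometricGraph n) (v u : Fin n) : G.adjInt v u = G.adjInt u v := by
  classical
  unfold adjInt
  exact if_congr (G.graph.adj_comm _ _) rfl rfl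

-- Reversing either edge permutes the summation, so the sum S has four equal forms. Their terms add
-- up to `sum_side`, so S counts quadruples (v,u,w,x) whose two edges cross. A crossing yields 8 of
-- them: two orders of the edges and two orientations of each.
open Classical in
theorem sum_disjoint_side (G : GeometricGraph n) :
    ∑ v, ∑ u, ∑ w, ∑ x, G.adjInt v u * G.adjInt w x * (if u = x then 0 else G.side v u w x) =
      8 * G.crossings := by
  set S := ∑ v, ∑ u, ∑ w, ∑ x, G.adjInt v u * G.adjInt w x *
    (if u = x then 0 else G.side v u w x) with hS
  have s2 : S = ∑ v, ∑ u, ∑ w, ∑ x, G.adjInt v u * G.adjInt w x *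
      (if v = x then 0 else G.side u v w x) := by
    rw [Finset.sum_comm, hS]
    simp only [G.adjInt_comm]
  have s3 : S = ∑ v, ∑ u, ∑ w, ∑ x, G.adjInt v u * G.adjInt w x *
      (if u = w then 0 else G.side v u x w) := by
    rw [hS]
    refine Finset.sum_congr rfl fun v _ => Finset.sum_congr rfl fun u _ => ?_
    rw [Finset.sum_comm]
    refine Finset.sum_congr rfl fun w _ => Finset.sum_congr rfl fun x _ => ?_
    rw [G.adjInt_comm x w]
  have s4 : S = ∑ v, ∑ u, ∑ w, ∑ x, G.adjInt v u * G.adjInt w x *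
      (if v = w then 0 else G.side u v x w) := by
    rw [s3, Finset.sum_comm]
    refine Finset.sum_congr rfl fun v _ => Finset.sum_congr rfl fun u _ => ?_
    simp only [G.adjInt_comm u v]
  have h4 : 4 * S = 4 * ∑ v, ∑ u, if G.graph.Adj v u then
      (∑ w, ∑ x, if G.graph.Adj w x then
        (if G.crossingGraph.Adj s(v, u) s(w, x) then 1 else 0) else 0) else 0 := by
    have : 4 * S = S + S + S + S := by ring
    rw [this]
    nth_rw 4 [s4]
    nth_rw 3 [s3]
    nth_rw 2 [s2]
    rw [hS]
    simp only [← Finset.sum_add_distrib, Finset.mul_sum]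
    refine Finset.sum_congr rfl fun v _ => Finset.sum_congr rfl fun u _ => ?_
    by_cases hvu : G.graph.Adj v u
    · rw [if_pos hvu, Finset.mul_sum]
      refine Finset.sum_congr rfl fun w _ => ?_
      rw [Finset.mul_sum]
      refine Finset.sum_congr rfl fun x _ => ?_
      by_cases hwx : G.graph.Adj w x
      · have := G.sum_side hvu.ne hwx.ne
        simp only [adjInt, hvu, hwx, if_true, one_mul]
        rw [this]
        simp [crossingGraph, hvu, hwx]
      · simp [adjInt, hwx]
    · simp [adjInt, hvu]
  have h5 : S = 4 * ∑ e, ∑ f, if G.crossingGraph.Adj e f then 1 else 0 := by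
    have h6 : ∀ e, ∑ w, ∑ x, (if G.graph.Adj w x then
        (if G.crossingGraph.Adj e s(w, x) then 1 else 0 : ℤ) else 0) =
        2 * ∑ f, if G.crossingGraph.Adj e f then 1 else 0 := by
      intro e
      rw [sum_adj_mk G.graph (fun f => if G.crossingGraph.Adj e f then 1 else 0)]
      congr 1
      refine Finset.sum_congr rfl fun f _ => ?_
      by_cases hf : f ∈ G.graph.edgeSet <;> simp [hf, crossingGraph]
    have h7 := mul_left_cancel₀ (by norm_num) h4
    rw [h7]
    simp only [h6]
    rw [sum_adj_mk G.graph (fun e => 2 * ∑ f, if G.crossingGraph.Adj e f then 1 else 0),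
      show (4 : ℤ) = 2 * 2 by norm_num, mul_assoc]
    congr 1
    rw [Finset.mul_sum]
    refine Finset.sum_congr rfl fun e _ => ?_
    by_cases he : e ∈ G.graph.edgeSet <;> simp [he, crossingGraph]
  rw [h5, ← two_mul_crossings]
  ring

/-- For distinct neighbours v, w of u the summand is the square of a nonzero sign; for v = w it is
0. What remains is the number of ordered pairs of distinct neighbours of u. -/
theorem sum_common_side (G : GeometricGraph n) :
    ∑ v, ∑ u, ∑ w, G.adjInt v u * G.adjInt w u * G.side v u w u =
      ∑ u, ((∑ v, G.adjInt u v) * ((∑ v, G.adjInt u v) - 1)) := by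
  classical
  rw [Finset.sum_comm]
  refine Finset.sum_congr rfl fun u _ => ?_
  have h : ∀ v w, G.adjInt v u * G.adjInt w u * G.side v u w u =
      G.adjInt u v * G.adjInt u w - if v = w then G.adjInt u v else 0 := by
    intro v w
    rw [G.adjInt_comm v, G.adjInt_comm w]
    by_cases hv : G.graph.Adj u v
    · by_cases hw : G.graph.Adj u w
      · by_cases hvw : v = w
        · subst hvw; simp [side, orientSign, adjInt, hv]
        · have := G.orient_ne_zero hvw hv.ne.symm hw.ne.symm
          rcases lt_or_gt_of_ne this with h | h <;> simp [side, orientSign, adjInt, hv, hw, hvw, h]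
      · have : v ≠ w := fun h => hw (h ▸ hv)
        simp [adjInt, hw, this]
    · simp [adjInt, hv]
  simp only [h, Finset.sum_sub_distrib, Finset.sum_ite_eq, Finset.mem_univ, if_true, mul_sub,
    mul_one, Finset.sum_mul_sum]

theorem sum_all_side (G : GeometricGraph n) :
    ∑ v, ∑ w, ∑ u, ∑ x, G.adjInt v u * G.adjInt w x * G.side v u w x =
      8 * G.crossings + ∑ u, ((∑ v, G.adjInt u v) * ((∑ v, G.adjInt u v) - 1)) := by
  classical
  rw [← sum_disjoint_side, ← sum_common_side, ← Finset.sum_add_distrib]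
  refine Finset.sum_congr rfl fun v _ => ?_
  rw [Finset.sum_comm, ← Finset.sum_add_distrib]
  refine Finset.sum_congr rfl fun u _ => ?_
  rw [← Finset.sum_add_distrib]
  refine Finset.sum_congr rfl fun w _ => ?_
  -- The full sum and the sum over distinct far ends differ only in the term x = u.
  rw [← sub_eq_iff_eq_add', ← Finset.sum_sub_distrib]
  rw [Finset.sum_eq_single u]
  · simp
  · intro x _ hx
    simp [hx.symm]
  · simp

/-- The signed count of the neighbours of `v` above and below the line through `v` and `w`
determines the number of crossings. The function `ε` orients each line. -/
theorem sum_signed_counts (G : GeometricGraph n) (ε D : Fin n → Fin n → ℤ)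
    (hε : ∀ v w, v ≠ w → ε v w * ε w v = -1)
    (hD : ∀ v w, v ≠ w → D v w = ∑ u, G.adjInt v u * (ε v w * G.orientSign v w u)) :
    ∑ v, ∑ w, (if v = w then 0 else D v w * D w v) =
      8 * G.crossings + ∑ u, ((∑ v, G.adjInt u v) * ((∑ v, G.adjInt u v) - 1)) := by
  rw [← sum_all_side]
  refine Finset.sum_congr rfl fun v _ => Finset.sum_congr rfl fun w _ => ?_
  by_cases hvw : v = w
  · subst hvw; simp [side, orientSign]
  · rw [if_neg hvw, hD v w hvw, hD w v (Ne.symm hvw), Finset.sum_mul_sum]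
    refine Finset.sum_congr rfl fun u _ => Finset.sum_congr rfl fun x _ => ?_
    have : G.orientSign w v x = - G.orientSign v w x := by
      rw [orientSign, orient_swap_left, Left.sign_neg, orientSign]; simp
    rw [this, side]
    linear_combination (-G.adjInt v u * G.adjInt w x * G.orientSign v w u * G.orientSign v w x) *
      hε v w hvw

end GeometricGraph

namespace RealRAM

/-! Total correctness with time bounds. -/

/-- `WP W p Q s`: the program `p` started in `s` halts after some time `t` in some state `s'`
with `Q t s'`. -/
def WP (W : ℕ) (p : Program) (Q : ℕ → State → Prop) (s : State) : Prop :=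
  ∃ t s', Runs W p s t s' ∧ Q t s'

variable {W : ℕ} {p q : Program} {b : Test} {Q R : ℕ → State → Prop} {s : State}

theorem WP.mono (h : WP W p Q s) (hQR : ∀ t s', Q t s' → R t s') : WP W p R s := by
  obtain ⟨t, s', hr, hq⟩ := h
  exact ⟨t, s', hr, hQR t s' hq⟩

theorem WP.skip (h : Q 0 s) : WP W .skip Q s := ⟨0, s, .skip s, h⟩

theorem WP.seq (h : WP W p (fun t s' => WP W q (fun t' => Q (t + t')) s') s) :
    WP W (.seq p q) Q s := by
  obtain ⟨t, s', hr, t', s'', hr', hq⟩ := h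
  exact ⟨_, _, .seq hr hr', hq⟩

theorem WP.ite (h1 : b.Holds s → WP W p (fun t => Q (t + 1)) s)
    (h2 : ¬ b.Holds s → WP W q (fun t => Q (t + 1)) s) : WP W (.ifThenElse b p q) Q s := by
  by_cases hb : b.Holds s
  · obtain ⟨t, s', hr, hq⟩ := h1 hb
    exact ⟨_, _, .ifTrue hb hr, hq⟩
  · obtain ⟨t, s', hr, hq⟩ := h2 hb
    exact ⟨_, _, .ifFalse hb hr, hq⟩

/-- While loops with an invariant `I` and a potential `Φ` that pays for the time. -/
theorem WP.while_ (I : State → Prop) (Φ : State → ℕ)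
    (hbody : ∀ s, I s → b.Holds s → WP W p (fun t s' => I s' ∧ t + 1 + Φ s' ≤ Φ s) s)
    (h0 : I s) : WP W (.whileDo b p) (fun t s' => I s' ∧ ¬ b.Holds s' ∧ t ≤ Φ s + 1) s := by
  induction h : Φ s using Nat.strong_induction_on generalizing s with
  | _ m ih =>
  by_cases hb : b.Holds s
  · obtain ⟨t, s', hr, hI, ht⟩ := hbody s h0 hb
    obtain ⟨t', s'', hr', hI', hb', ht'⟩ := ih (Φ s') (by omega) hI rfl
    exact ⟨_, _, .whileTrue hb hr hr', hI', hb', by omega⟩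
  · exact ⟨_, _, .whileFalse hb, h0, hb, by omega⟩

/-! Frame properties: which registers and arrays a program may change. -/

/-- Whether the instruction may change word register `k`. -/
def Instr.writesWReg : Instr → ℕ → Bool
  | .wconst d _, k => d == k
  | .wop _ d _ _, k => d == k
  | .wload d _ _, k => d == k
  | _, _ => false

/-- Whether the instruction may change word array `k`. -/
def Instr.writesWMem : Instr → ℕ → Bool
  | .wstore a _ _, k => a == k
  | _, _ => false

/-- Whether the instruction may change real array `k`. -/
def Instr.writesRMem : Instr → ℕ → Bool
  | .rstore a _ _, k => a == k
  | _, _ => false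

/-- Whether the program contains an instruction that satisfies `f`. -/
def Program.any (f : Instr → Bool) : Program → Bool
  | .skip => false
  | .instr c => f c
  | .seq p q => p.any f || q.any f
  | .ifThenElse _ p q => p.any f || q.any f
  | .whileDo _ p => p.any f

/-- The projection `g` is arbitrary, so that a single induction on runs yields every component of
`Frame`. -/
theorem Runs.preserves {α : Type*} {f : Instr → Bool} {g : State → α}
    (hf : ∀ c s s', f c = false → c.exec W s = some s' → g s' = g s) {t : ℕ} {s' : State}
    (h : Runs W p s t s') (hp : p.any f = false) : g s' = g s := by
  induction h with
  | skip s => rfl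
  | instr h => exact hf _ _ _ hp h
  | seq _ _ ih ih' =>
    simp only [Program.any, Bool.or_eq_false_iff] at hp
    rw [ih' hp.2, ih hp.1]
  | ifTrue _ _ ih =>
    simp only [Program.any, Bool.or_eq_false_iff] at hp
    exact ih hp.1
  | ifFalse _ _ ih =>
    simp only [Program.any, Bool.or_eq_false_iff] at hp
    exact ih hp.2
  | whileTrue _ _ _ ih ih' => rw [ih' hp, ih hp]
  | whileFalse _ => rfl

theorem State.setWord_eq_some {d v : ℕ} {s' : State} :
    s.setWord W d v = some s' ↔ v < W ∧ { s with wreg := Function.update s.wreg d v } = s' := by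
  unfold State.setWord
  split_ifs with h <;> simp [h]

/-- `s'` agrees with `s` on everything live that `p` does not write. -/
structure Frame (p : Program) (s s' : State) : Prop where
  wreg : ∀ k, p.any (fun c => c.writesWReg k) = false → s'.wreg k = s.wreg k
  wmem : ∀ k, p.any (fun c => c.writesWMem k) = false → s'.wmem k = s.wmem k
  rmem : ∀ k, p.any (fun c => c.writesRMem k) = false → s'.rmem k = s.rmem k

theorem Runs.frame {t : ℕ} {s' : State} (h : Runs W p s t s') : Frame p s s' where
  wreg k := h.preserves (g := fun s => s.wreg k) <| by
    intro c s s' hc he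
    cases c <;> simp only [Instr.exec, State.setWord_eq_some, Option.bind_eq_some_iff,
      Option.map_eq_some_iff, Option.some.injEq, Instr.writesWReg, beq_eq_false_iff_ne] at he hc
    case wconst => rw [← he.2]; exact Function.update_of_ne hc.symm _ _
    case wop => obtain ⟨_, _, he⟩ := he; rw [← he.2]; exact Function.update_of_ne hc.symm _ _
    case wload => rw [← he.2]; exact Function.update_of_ne hc.symm _ _
    case rop => obtain ⟨_, _, he⟩ := he; rw [← he]; first | done | rfl
    all_goals rw [← he]; first | done | rfl
  wmem k := h.preserves (g := fun s => s.wmem k) <| by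
    intro c s s' hc he
    cases c <;> simp only [Instr.exec, State.setWord_eq_some, Option.bind_eq_some_iff,
      Option.map_eq_some_iff, Option.some.injEq, Instr.writesWMem, beq_eq_false_iff_ne] at he hc
    case wstore => rw [← he]; exact Function.update_of_ne hc.symm _ _
    case wop => obtain ⟨_, _, he⟩ := he; rw [← he.2]
    case rop => obtain ⟨_, _, he⟩ := he; rw [← he]; first | done | rfl
    case wconst => rw [← he.2]
    case wload => rw [← he.2]
    all_goals rw [← he]; first | done | rfl
  rmem k := h.preserves (g := fun s => s.rmem k) <| by
    intro c s s' hc he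
    cases c <;> simp only [Instr.exec, State.setWord_eq_some, Option.bind_eq_some_iff,
      Option.map_eq_some_iff, Option.some.injEq, Instr.writesRMem, beq_eq_false_iff_ne] at he hc
    case rstore => rw [← he]; exact Function.update_of_ne hc.symm _ _
    case wop => obtain ⟨_, _, he⟩ := he; rw [← he.2]
    case rop => obtain ⟨_, _, he⟩ := he; rw [← he]; first | done | rfl
    case wconst => rw [← he.2]
    case wload => rw [← he.2]
    all_goals rw [← he]; first | done | rfl

theorem Frame.refl (p : Program) (s : State) : Frame p s s := ⟨by simp, by simp, by simp⟩

theorem Frame.trans {s' s'' : State} (h : Frame p s s') (h' : Frame p s' s'') : Frame p s s'' :=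
  ⟨fun k hk => (h'.wreg k hk).trans (h.wreg k hk), fun k hk => (h'.wmem k hk).trans (h.wmem k hk),
    fun k hk => (h'.rmem k hk).trans (h.rmem k hk)⟩

theorem WP.frame (h : WP W p Q s) : WP W p (fun t s' => Q t s' ∧ Frame p s s') s := by
  obtain ⟨t, s', hr, hq⟩ := h
  exact ⟨t, s', hr, hq, hr.frame⟩

/-- The while rule, with the frame property of the loop available in the body and at the end. -/
theorem WP.while_frame (I : State → Prop) (Φ : State → ℕ)
    (hbody : ∀ s', Frame (.whileDo b p) s s' → I s' → b.Holds s' →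
      WP W p (fun t s'' => I s'' ∧ t + 1 + Φ s'' ≤ Φ s') s')
    (h0 : I s) : WP W (.whileDo b p)
      (fun t s' => Frame (.whileDo b p) s s' ∧ I s' ∧ ¬ b.Holds s' ∧ t ≤ Φ s + 1) s := by
  refine (WP.while_ (fun s' => Frame (.whileDo b p) s s' ∧ I s') Φ ?_ ⟨.refl _ s, h0⟩).mono
    fun t s' h => ⟨h.1.1, h.1.2, h.2⟩
  rintro s' ⟨hf, hI⟩ hb
  exact (hbody s' hf hI hb).frame.mono fun t s'' h =>
    ⟨⟨hf.trans ⟨h.2.wreg, h.2.wmem, h.2.rmem⟩, h.1.1⟩, h.1.2⟩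

/-! Straight line code. -/

/-- A sequence of instructions as a program. -/
def block : List Instr → Program
  | [] => .skip
  | c :: l => .seq (.instr c) (block l)

/-- Write the word `v` to register `d`. -/
def State.putWord (s : State) (d v : ℕ) : State :=
  { s with wreg := Function.update s.wreg d v }

/-- Write the word `v` to entry `k` of array `a`. -/
def State.storeWord (s : State) (a k v : ℕ) : State :=
  { s with wmem := Function.update s.wmem a (Function.update (s.wmem a) k v) }

/-- Write the real `v` to entry `k` of array `a`. -/
def State.storeReal (s : State) (a k : ℕ) (v : ℝ) : State :=
  { s with rmem := Function.update s.rmem a (Function.update (s.rmem a) k v) }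

section simp_lemmas

variable (s : State) (d i a k m c : ℕ) (v : ℕ) (x : ℝ)

@[simp] theorem putWord_wreg : (s.putWord d v).wreg i = if i = d then v else s.wreg i := by
  simp [State.putWord, Function.update_apply]
@[simp] theorem putWord_rreg : (s.putWord d v).rreg = s.rreg := rfl
@[simp] theorem putWord_wmem : (s.putWord d v).wmem = s.wmem := rfl
@[simp] theorem putWord_rmem : (s.putWord d v).rmem = s.rmem := rfl
@[simp] theorem setReal_rreg : (s.setReal d x).rreg i = if i = d then x else s.rreg i := by
  simp [State.setReal, Function.update_apply]
@[simp] theorem setReal_wreg : (s.setReal d x).wreg = s.wreg := rfl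
@[simp] theorem setReal_wmem : (s.setReal d x).wmem = s.wmem := rfl
@[simp] theorem setReal_rmem : (s.setReal d x).rmem = s.rmem := rfl
@[simp] theorem storeWord_wmem : (s.storeWord a k v).wmem c m =
    if c = a ∧ m = k then v else s.wmem c m := by
  simp only [State.storeWord, Function.update_apply]
  split_ifs <;> simp_all
@[simp] theorem storeWord_wreg : (s.storeWord a k v).wreg = s.wreg := rfl
@[simp] theorem storeWord_rmem : (s.storeWord a k v).rmem = s.rmem := rfl
@[simp] theorem storeReal_rmem : (s.storeReal a k x).rmem c m =
    if c = a ∧ m = k then x else s.rmem c m := by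
  simp only [State.storeReal, Function.update_apply]
  split_ifs <;> simp_all
@[simp] theorem storeReal_wreg : (s.storeReal a k x).wreg = s.wreg := rfl
@[simp] theorem storeReal_wmem : (s.storeReal a k x).wmem = s.wmem := rfl

end simp_lemmas

/-- The value of a word operation, where defined. -/
@[simp] def WordOp.val : WordOp → ℕ → ℕ → ℕ
  | .add, x, y => x + y
  | .sub, x, y => x - y
  | .mul, x, y => x * y
  | .div, x, y => x / y

/-- The value of a real operation, where defined. -/
@[simp] noncomputable def RealOp.val : RealOp → ℝ → ℝ → ℝ
  | .add, x, y => x + y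
  | .sub, x, y => x - y
  | .mul, x, y => x * y
  | .div, x, y => x / y

/-- The operation is defined on operands of which the second is `y`. -/
@[simp] def WordOp.Ok : WordOp → ℕ → Prop
  | .div, y => y ≠ 0
  | _, _ => True

/-- The operation is defined on operands of which the second is `y`. -/
@[simp] def RealOp.Ok : RealOp → ℝ → Prop
  | .div, y => y ≠ 0
  | _, _ => True

/-- The effect of an instruction that does not get stuck. -/
@[simp] noncomputable def Instr.effect (s : State) : Instr → State
  | .wconst d k => s.putWord d k
  | .wop op d i j => s.putWord d (op.val (s.wreg i) (s.wreg j))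
  | .wload d a i => s.putWord d (s.wmem a (s.wreg i))
  | .wstore a i r => s.storeWord a (s.wreg i) (s.wreg r)
  | .rcast d i => s.setReal d (s.wreg i)
  | .rop op d i j => s.setReal d (op.val (s.rreg i) (s.rreg j))
  | .rload d a i => s.setReal d (s.rmem a (s.wreg i))
  | .rstore a i r => s.storeReal a (s.wreg i) (s.rreg r)

/-- The condition under which an instruction does not get stuck. -/
@[simp] def Instr.Ok (W : ℕ) (s : State) : Instr → Prop
  | .wconst _ k => k < W
  | .wop op _ i j => op.Ok (s.wreg j) ∧ op.val (s.wreg i) (s.wreg j) < W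
  | .wload _ a i => s.wmem a (s.wreg i) < W
  | .rop op _ _ j => op.Ok (s.rreg j)
  | _ => True

/-- Separating a total effect from a side condition lets the simplifier execute straight line code,
leaving overflow and division by zero as arithmetic goals. -/
theorem Instr.exec_eq (c : Instr) (h : c.Ok W s) : c.exec W s = some (c.effect s) := by
  cases c with
  | wconst d k => exact if_pos h
  | wop op d i j =>
    cases op <;> simp_all [Instr.exec, WordOp.eval, State.setWord, State.putWord]
  | wload d a i => exact if_pos h
  | wstore a i r => rfl
  | rcast d i => rfl
  | rop op d i j => cases op <;> simp_all [Instr.exec, RealOp.eval]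
  | rload d a i => rfl
  | rstore a i r => rfl

/-- The effect of straight line code. -/
@[simp] noncomputable def effects : List Instr → State → State
  | [], s => s
  | c :: l, s => effects l (c.effect s)

/-- The condition under which straight line code does not get stuck. -/
@[simp] def Oks (W : ℕ) : List Instr → State → Prop
  | [], _ => True
  | c :: l, s => c.Ok W s ∧ Oks W l (c.effect s)

theorem WP.block {l : List Instr} (hl : Oks W l s) (h : Q l.length (effects l s)) :
    WP W (block l) Q s := by
  induction l generalizing s Q with
  | nil => exact .skip h
  | cons c l ih =>
    refine .seq ⟨1, _, .instr (c.exec_eq hl.1), ih hl.2 ?_⟩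
    rw [add_comm]
    exact h

/-! Counting loops. -/

/-- `for i := i, …, m - 1 do p`, where word register `one` holds `1`. -/
def forLoop (i m one : ℕ) (p : Program) : Program :=
  .whileDo (.wlt i m) (.seq p (block [.wop .add i i one]))

/-- Counting loops whose body takes time at most `C`. The frame property of the loop is available
in the body and at the end. -/
theorem WP.forLoop {i m one N C : ℕ} (I : ℕ → State → Prop)
    (hi : s.wreg i = 0) (hm : s.wreg m = N) (hone : s.wreg one = 1)
    (hpi : p.any (fun c => c.writesWReg i) = false)
    (hpm : p.any (fun c => c.writesWReg m) = false)
    (hpone : p.any (fun c => c.writesWReg one) = false)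
    (him : i ≠ m) (hio : i ≠ one) (hN : N < W) (h0 : I 0 s)
    (hbody : ∀ k s', k < N → Frame (forLoop i m one p) s s' → s'.wreg i = k → I k s' →
      WP W p (fun t s'' => t ≤ C ∧ I (k + 1) (s''.putWord i (k + 1))) s') :
    WP W (forLoop i m one p)
      (fun t s' => Frame (forLoop i m one p) s s' ∧ I N s' ∧ s'.wreg i = N ∧ t ≤ N * (C + 2) + 1)
      s := by
  have hany : ∀ k, k ≠ i → p.any (fun c => c.writesWReg k) = false →
      (RealRAM.forLoop i m one p).any (fun c => c.writesWReg k) = false := by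
    intro k hk hp
    rw [RealRAM.forLoop, Program.any, Program.any, hp]
    simp [Program.any, RealRAM.block, Instr.writesWReg, hk.symm]
  -- A round pays `C` for the body, 1 for the test and 1 for the increment.
  have key := WP.while_frame (W := W) (s := s) (b := .wlt i m)
    (p := .seq p (RealRAM.block [.wop .add i i one]))
    (fun s' => s'.wreg i ≤ N ∧ I (s'.wreg i) s') (fun s' => (N - s'.wreg i) * (C + 2)) ?_
    ⟨by omega, by rwa [hi]⟩
  · refine key.mono fun t s' ⟨hf, ⟨hle, hI⟩, hb, ht⟩ => ?_
    have h1 : s'.wreg m = N := (hf.wreg m (hany m him.symm hpm)).trans hm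
    have h2 : s'.wreg i = N := by
      simp only [Test.Holds, h1] at hb
      omega
    refine ⟨hf, h2 ▸ hI, h2, ?_⟩
    rwa [hi, Nat.sub_zero] at ht
  · intro s' hf ⟨hle, hI⟩ hb
    have h1 : s'.wreg m = N := (hf.wreg m (hany m him.symm hpm)).trans hm
    have h2 : s'.wreg one = 1 := (hf.wreg one (hany one hio.symm hpone)).trans hone
    have hlt : s'.wreg i < N := by
      simp only [Test.Holds, h1] at hb
      exact hb
    refine .seq ((hbody _ s' hlt hf rfl hI).frame.mono fun t s'' ⟨⟨ht, hI'⟩, hf'⟩ => ?_)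
    have e1 : s''.wreg i = s'.wreg i := hf'.wreg i hpi
    have e2 : s''.wreg one = 1 := (hf'.wreg one hpone).trans h2
    refine .block ?_ ?_
    · simp only [Oks, Instr.Ok, WordOp.Ok, WordOp.val, e1, e2, true_and, and_true]
      omega
    · simp only [effects, Instr.effect, WordOp.val, e1, e2, putWord_wreg, if_true, List.length]
      refine ⟨⟨hlt, hI'⟩, ?_⟩
      obtain ⟨r, hr⟩ := Nat.exists_eq_add_of_lt hlt
      rw [show N - (s'.wreg i + 1) = r by omega, show N - s'.wreg i = r + 1 by omega]
      nlinarith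

end RealRAM

namespace RealRAM

/-! Merge sort. Word register `0` holds `n` and word register `3` holds `1`. Word array `1` holds the
list of indices to be sorted, real array `2` holds their keys, and word array `2` is a buffer. -/

/-- Append the entry with index in register `i` to the buffer and increment the index. -/
def takeEntry (i : ℕ) : Program := block [.wload 27 1 i, .wstore 2 26 27, .wop .add i i 3]

/-- One step of a merge of two sorted blocks that end at registers `22`, `23`. -/
def mergeStep : Program :=
  .seq
    (.ifThenElse (.wlt 24 22)
      (.ifThenElse (.wlt 25 23)
        (.seq (block [.wload 27 1 24, .wload 28 1 25, .rload 0 2 27, .rload 1 2 28])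
          (.ifThenElse (.rlt 1 0) (takeEntry 25) (takeEntry 24)))
        (takeEntry 24))
      (takeEntry 25))
    (block [.wop .add 26 26 3])

/-- Merge two sorted blocks. -/
def mergeLoop : Program := .whileDo (.wlt 26 23) mergeStep

/-- Merge the blocks `[lo, lo + width)` and `[lo + width, lo + 2 * width)`, cut off at `n`, where
`lo` is in register `21` and `width` is in register `20`; then advance `lo`. -/
def mergeBlocks : Program :=
  .seq (block [.wop .add 22 21 20, .wop .sub 22 0 22, .wop .sub 22 0 22,
      .wop .add 23 22 20, .wop .sub 23 0 23, .wop .sub 23 0 23,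
      .wop .mul 24 21 3, .wop .mul 25 22 3, .wop .mul 26 21 3])
    (.seq mergeLoop (block [.wop .mul 21 23 3]))

/-- Copy the buffer back and double the width. -/
def copyBack : Program :=
  .seq (block [.wconst 21 0])
    (.seq (forLoop 21 0 3 (block [.wload 27 2 21, .wstore 1 21 27]))
      (block [.wop .add 20 20 20]))

/-- One pass of merge sort. -/
def mergePass : Program :=
  .seq (block [.wconst 21 0]) (.seq (.whileDo (.wlt 21 0) mergeBlocks) copyBack)

/-- Bottom-up merge sort. -/
def mergeSort : Program :=
  .seq (block [.wconst 20 1]) (.whileDo (.wlt 20 0) mergePass)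

variable {W n : ℕ} {s : State}

theorem takeEntry_spec {i : ℕ} (hi : i = 24 ∨ i = 25) (h3 : s.wreg 3 = 1)
    (hiW : s.wreg i + 1 < W) (hA : s.wmem 1 (s.wreg i) < W) :
    WP W (takeEntry i) (fun t s' => t = 3 ∧ s'.wreg i = s.wreg i + 1 ∧
      s'.wmem 2 = Function.update (s.wmem 2) (s.wreg 26) (s.wmem 1 (s.wreg i))) s := by
  have e1 : i ≠ 27 := by omega
  refine .block ?_ ?_
  · simp [e1, h3, hA, hiW]
  · refine ⟨rfl, by simp [h3, e1], ?_⟩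
    ext m
    simp [Function.update_apply]

/-- The right entry is taken only if its key is strictly smaller. With this rule for ties the step
agrees with the recursion of `List.merge` for `keyLE`. -/
theorem mergeStep_spec {i j k mid hi : ℕ} (h3 : s.wreg 3 = 1) (h24 : s.wreg 24 = i)
    (h25 : s.wreg 25 = j) (h26 : s.wreg 26 = k) (h22 : s.wreg 22 = mid) (h23 : s.wreg 23 = hi)
    (hij : i < mid ∨ j < hi) (hmid : mid < W) (hhi : hi < W) (hkW : k + 1 < W)
    (hAi : i < mid → s.wmem 1 i < W) (hAj : j < hi → s.wmem 1 j < W) :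
    WP W mergeStep (fun t s' => t ≤ 12 ∧ s'.wreg 26 = k + 1 ∧
      ((i < mid ∧ (j < hi → s.rmem 2 (s.wmem 1 i) ≤ s.rmem 2 (s.wmem 1 j)) ∧
          s'.wreg 24 = i + 1 ∧ s'.wreg 25 = j ∧
          s'.wmem 2 = Function.update (s.wmem 2) k (s.wmem 1 i)) ∨
        (j < hi ∧ (i < mid → s.rmem 2 (s.wmem 1 j) < s.rmem 2 (s.wmem 1 i)) ∧
          s'.wreg 24 = i ∧ s'.wreg 25 = j + 1 ∧
          s'.wmem 2 = Function.update (s.wmem 2) k (s.wmem 1 j)))) s := by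
  -- Stated for a state that may differ from `s` in scratch registers, since one of the paths to
  -- this branch has loaded the two entries and their keys before.
  have left : ∀ s₁ : State, (∀ r, r < 27 → s₁.wreg r = s.wreg r) → s₁.wmem = s.wmem → i < mid →
      WP W (takeEntry 24) (fun t s' => t = 3 ∧ s'.wreg 3 = 1 ∧ s'.wreg 26 = k ∧
        s'.wreg 24 = i + 1 ∧ s'.wreg 25 = j ∧
        s'.wmem 2 = Function.update (s.wmem 2) k (s.wmem 1 i)) s₁ := by
    intro s₁ hr hm hlt
    have e24 : s₁.wreg 24 = i := by rw [hr _ (by omega), h24]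
    refine (takeEntry_spec (.inl rfl) (by rw [hr _ (by omega), h3]) (by omega)
      (by rw [hm, e24]; exact hAi hlt)).frame.mono fun t s' ⟨⟨ht, h, h'⟩, hf⟩ => ?_
    refine ⟨ht, ?_, ?_, by rw [h, e24], ?_, ?_⟩
    · rw [hf.wreg 3 rfl, hr _ (by omega), h3]
    · rw [hf.wreg 26 rfl, hr _ (by omega), h26]
    · rw [hf.wreg 25 rfl, hr _ (by omega), h25]
    · rw [h', hm, e24, hr _ (by omega), h26]
  have right : ∀ s₁ : State, (∀ r, r < 27 → s₁.wreg r = s.wreg r) → s₁.wmem = s.wmem → j < hi →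
      WP W (takeEntry 25) (fun t s' => t = 3 ∧ s'.wreg 3 = 1 ∧ s'.wreg 26 = k ∧
        s'.wreg 24 = i ∧ s'.wreg 25 = j + 1 ∧
        s'.wmem 2 = Function.update (s.wmem 2) k (s.wmem 1 j)) s₁ := by
    intro s₁ hr hm hlt
    have e25 : s₁.wreg 25 = j := by rw [hr _ (by omega), h25]
    refine (takeEntry_spec (.inr rfl) (by rw [hr _ (by omega), h3]) (by omega)
      (by rw [hm, e25]; exact hAj hlt)).frame.mono fun t s' ⟨⟨ht, h, h'⟩, hf⟩ => ?_
    refine ⟨ht, ?_, ?_, ?_, by rw [h, e25], ?_⟩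
    · rw [hf.wreg 3 rfl, hr _ (by omega), h3]
    · rw [hf.wreg 26 rfl, hr _ (by omega), h26]
    · rw [hf.wreg 24 rfl, hr _ (by omega), h24]
    · rw [h', hm, e25, hr _ (by omega), h26]
  have last : ∀ (s₁ : State) (Q : ℕ → State → Prop), s₁.wreg 3 = 1 → s₁.wreg 26 = k →
      Q 1 (s₁.putWord 26 (k + 1)) → WP W (block [.wop .add 26 26 3]) Q s₁ := by
    intro s₁ Q e3 e26 hQ
    refine .block ?_ ?_
    · simpa [e3, e26] using hkW
    · simpa [e3, e26] using hQ
  refine .seq (.ite ?_ ?_)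
  · intro hlt
    simp only [Test.Holds, h24, h22] at hlt
    refine .ite ?_ ?_
    · intro hlt2
      simp only [Test.Holds, h25, h23] at hlt2
      refine .seq (.block ?_ (.ite ?_ ?_))
      · simp [h24, h25, hAi hlt, hAj hlt2]
      · intro hc
        simp [Test.Holds, h24, h25] at hc
        refine (right (effects _ _) ?_ rfl hlt2).mono fun t s' ⟨ht, h3', h26', h24', h25', hm'⟩ => ?_
        · intro r hr
          simp [show r ≠ 27 by omega, show r ≠ 28 by omega]
        refine last _ _ h3' h26' ⟨by simp [ht], by simp, .inr ⟨hlt2, fun _ => hc, ?_⟩⟩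
        simp [h24', h25', hm']
      · intro hc
        simp [Test.Holds, h24, h25] at hc
        refine (left (effects _ _) ?_ rfl hlt).mono fun t s' ⟨ht, h3', h26', h24', h25', hm'⟩ => ?_
        · intro r hr
          simp [show r ≠ 27 by omega, show r ≠ 28 by omega]
        refine last _ _ h3' h26' ⟨by simp [ht], by simp, .inl ⟨hlt, fun _ => hc, ?_⟩⟩
        simp [h24', h25', hm']
    · intro hlt2
      simp only [Test.Holds, h25, h23] at hlt2
      refine (left s (fun _ _ => rfl) rfl hlt).mono
        fun t s' ⟨ht, h3', h26', h24', h25', hm'⟩ => ?_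
      refine last _ _ h3' h26' ⟨by omega, by simp, .inl ⟨hlt, fun h => absurd h hlt2, ?_⟩⟩
      simp [h24', h25', hm']
  · intro hlt
    simp only [Test.Holds, h24, h22] at hlt
    refine (right s (fun _ _ => rfl) rfl (hij.resolve_left hlt)).mono
      fun t s' ⟨ht, h3', h26', h24', h25', hm'⟩ => ?_
    refine last _ _ h3' h26' ⟨by omega, by simp,
      .inr ⟨hij.resolve_left hlt, fun h => absurd h hlt, ?_⟩⟩
    simp [h24', h25', hm']

/-! ### Merging of array segments. -/

/-- The values of `f` on `[a, b)`, in order. -/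
def slice (f : ℕ → ℕ) (a b : ℕ) : List ℕ := (List.range' a (b - a)).map f

theorem slice_self (f : ℕ → ℕ) (a : ℕ) : slice f a a = [] := by simp [slice]

theorem slice_of_lt (f : ℕ → ℕ) {a b : ℕ} (h : a < b) :
    slice f a b = f a :: slice f (a + 1) b := by
  rw [slice, show b - a = (b - (a + 1)) + 1 by omega, List.range'_succ]
  rfl

theorem slice_append (f : ℕ → ℕ) {a b c : ℕ} (hab : a ≤ b) (hbc : b ≤ c) :
    slice f a b ++ slice f b c = slice f a c := by
  rw [slice, slice, slice, ← List.map_append]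
  congr 1
  have := List.range'_append_1 (s := a) (m := b - a) (n := c - b)
  rw [show a + (b - a) = b by omega, show b - a + (c - b) = c - a by omega] at this
  exact this

theorem slice_congr {f g : ℕ → ℕ} {a b : ℕ} (h : ∀ k, a ≤ k → k < b → f k = g k) :
    slice f a b = slice g a b := by
  refine List.map_congr_left fun k hk => ?_
  rw [List.mem_range'_1] at hk
  exact h k hk.1 (by omega)

theorem slice_succ (f : ℕ → ℕ) {a b : ℕ} (h : a ≤ b) :
    slice f a (b + 1) = slice f a b ++ [f b] := by
  rw [← slice_append f h (Nat.le_succ b), slice_of_lt f (Nat.lt_succ_self b), slice_self]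

theorem mem_slice {f : ℕ → ℕ} {a b m : ℕ} : m ∈ slice f a b ↔ ∃ k, a ≤ k ∧ k < b ∧ f k = m := by
  simp only [slice, List.mem_map, List.mem_range'_1]
  constructor
  · rintro ⟨k, hk, rfl⟩
    exact ⟨k, hk.1, by omega, rfl⟩
  · rintro ⟨k, hk, hk', rfl⟩
    exact ⟨k, ⟨hk, by omega⟩, rfl⟩

theorem pairwise_slice {f : ℕ → ℕ} {a b : ℕ} {r : ℕ → ℕ → Prop} :
    (slice f a b).Pairwise r ↔ ∀ p q, a ≤ p → p < q → q < b → r (f p) (f q) := by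
  rw [slice, List.pairwise_map, List.pairwise_iff_getElem]
  simp only [List.length_range', List.getElem_range', one_mul]
  constructor
  · intro h p q hap hpq hqb
    have := h (p - a) (q - a) (by omega) (by omega) (by omega)
    rwa [show a + (p - a) = p by omega, show a + (q - a) = q by omega] at this
  · intro h i j hi hj hij
    exact h _ _ (by omega) (by omega) (by omega)

open Classical in
/-- Comparison of indices by their keys. -/
noncomputable def keyLE (κ : ℕ → ℝ) (i j : ℕ) : Bool := decide (κ i ≤ κ j)

/-- Invariant: what has been written, followed by the `List.merge` of what remains, is the final
result. The relation `i + j = k + mid` guarantees that an entry remains while `k < hi`, and that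
both blocks are exhausted at the end. Positions below `lo` are tracked because they hold the blocks
merged earlier in the same pass. -/
theorem mergeLoop_spec {lo mid hi : ℕ} (h3 : s.wreg 3 = 1) (h24 : s.wreg 24 = lo)
    (h25 : s.wreg 25 = mid) (h26 : s.wreg 26 = lo) (h22 : s.wreg 22 = mid) (h23 : s.wreg 23 = hi)
    (hlm : lo ≤ mid) (hmh : mid ≤ hi) (hhi : hi < W)
    (hA : ∀ k, lo ≤ k → k < hi → s.wmem 1 k < W) :
    WP W mergeLoop (fun t s' => t ≤ (hi - lo) * 13 + 1 ∧
      slice (s'.wmem 2) lo hi =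
        (slice (s.wmem 1) lo mid).merge (slice (s.wmem 1) mid hi) (keyLE (s.rmem 2)) ∧
      ∀ q < lo, s'.wmem 2 q = s.wmem 2 q) s := by
  set M := (slice (s.wmem 1) lo mid).merge (slice (s.wmem 1) mid hi) (keyLE (s.rmem 2)) with hM
  refine (WP.while_frame (fun s' => ∃ i j k, s'.wreg 24 = i ∧ s'.wreg 25 = j ∧ s'.wreg 26 = k ∧
    lo ≤ i ∧ i ≤ mid ∧ mid ≤ j ∧ j ≤ hi ∧ i + j = k + mid ∧
    slice (s'.wmem 2) lo k ++
      (slice (s.wmem 1) i mid).merge (slice (s.wmem 1) j hi) (keyLE (s.rmem 2)) = M ∧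
    ∀ q < lo, s'.wmem 2 q = s.wmem 2 q) (fun s' => (hi - s'.wreg 26) * 13) ?_ ?_).mono ?_
  · rintro s' hf ⟨i, j, k, e24, e25, e26, hli, him, hmj, hjh, hijk, hinv, hpre⟩ hb
    have e22 : s'.wreg 22 = mid := (hf.wreg 22 rfl).trans h22
    have e23 : s'.wreg 23 = hi := (hf.wreg 23 rfl).trans h23
    have e3 : s'.wreg 3 = 1 := (hf.wreg 3 rfl).trans h3
    have eA : s'.wmem 1 = s.wmem 1 := hf.wmem 1 rfl
    have eK : s'.rmem 2 = s.rmem 2 := hf.rmem 2 rfl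
    simp only [Test.Holds, e26, e23] at hb
    refine (mergeStep_spec e3 e24 e25 e26 e22 e23 (by omega) (by omega) hhi (by omega)
      (fun _ => by rw [eA]; exact hA _ (by omega) (by omega))
      (fun _ => by rw [eA]; exact hA _ (by omega) (by omega))).mono ?_
    rintro t s'' ⟨ht, h26', hcase⟩
    have hup : ∀ x, s''.wmem 2 = Function.update (s'.wmem 2) k x →
        slice (s''.wmem 2) lo (k + 1) = slice (s'.wmem 2) lo k ++ [x] ∧
        ∀ q < lo, s''.wmem 2 q = s.wmem 2 q := by
      intro x hx
      rw [slice_succ _ (by omega), hx]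
      refine ⟨?_, fun q hq => ?_⟩
      · rw [Function.update_self]
        congr 1
        exact slice_congr fun q _ hq => Function.update_of_ne hq.ne _ _
      · rw [Function.update_of_ne (by omega), hpre q hq]
    rw [eA, eK] at hcase
    have hpot : t + 1 + (hi - s''.wreg 26) * 13 ≤ (hi - s'.wreg 26) * 13 := by
      rw [h26', e26]; omega
    rcases hcase with ⟨hi', hle, h24', h25', hm⟩ | ⟨hj', hlt, h24', h25', hm⟩
    · obtain ⟨hs, hp⟩ := hup _ hm
      refine ⟨⟨_, _, _, h24', h25', h26', by omega, by omega, by omega, by omega, by omega, ?_, hp⟩,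
        hpot⟩
      rw [hs, ← hinv, List.append_assoc, slice_of_lt _ hi']
      congr 1
      by_cases hj : j < hi
      · rw [slice_of_lt _ hj, List.cons_merge_cons, if_pos (by simpa [keyLE] using hle hj)]
        rfl
      · rw [show j = hi by omega, slice_self]
        simp
    · obtain ⟨hs, hp⟩ := hup _ hm
      refine ⟨⟨_, _, _, h24', h25', h26', by omega, by omega, by omega, by omega, by omega, ?_, hp⟩,
        hpot⟩
      rw [hs, ← hinv, List.append_assoc, slice_of_lt _ hj']
      congr 1
      by_cases hi'' : i < mid
      · rw [slice_of_lt _ hi'', List.cons_merge_cons,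
          if_neg (by simpa [keyLE] using hlt hi'')]
        rfl
      · rw [show i = mid by omega, slice_self]
        simp
  · exact ⟨lo, mid, lo, h24, h25, h26, le_rfl, hlm, le_rfl, hmh, rfl, by rw [slice_self]; rfl,
      fun _ _ => rfl⟩
  · rintro t s' ⟨hf, ⟨i, j, k, e24, e25, e26, hli, him, hmj, hjh, hijk, hinv, hpre⟩, hb, ht⟩
    have e23 : s'.wreg 23 = hi := (hf.wreg 23 rfl).trans h23
    simp only [Test.Holds, e26, e23] at hb
    rw [h26] at ht
    refine ⟨ht, ?_, hpre⟩
    obtain rfl : i = mid := by omega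
    obtain rfl : j = hi := by omega
    obtain rfl : k = j := by omega
    rw [slice_self, slice_self] at hinv
    simpa using hinv

end RealRAM

namespace RealRAM
variable {W n : ℕ} {s : State}

theorem mergeBlocks_spec {w lo : ℕ} (h0 : s.wreg 0 = n) (h3 : s.wreg 3 = 1) (h20 : s.wreg 20 = w)
    (h21 : s.wreg 21 = lo) (hlo : lo < n) (hw : w < n) (hW : 2 * n < W)
    (hA : ∀ k < n, s.wmem 1 k < W) :
    WP W mergeBlocks (fun t s' => t ≤ (min (lo + 2 * w) n - lo) * 13 + 11 ∧
      s'.wreg 21 = min (lo + 2 * w) n ∧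
      slice (s'.wmem 2) lo (min (lo + 2 * w) n) =
        (slice (s.wmem 1) lo (min (lo + w) n)).merge
          (slice (s.wmem 1) (min (lo + w) n) (min (lo + 2 * w) n)) (keyLE (s.rmem 2)) ∧
      ∀ q < lo, s'.wmem 2 q = s.wmem 2 q) s := by
  -- Two truncated subtractions from `n` compute a minimum with `n`, without a branch.
  have e1 : n - (n - (lo + w)) = min (lo + w) n := by omega
  have e2 : n - (n - (min (lo + w) n + w)) = min (lo + 2 * w) n := by omega
  refine .seq (.block ?_ (.seq ?_))
  · simp [h0, h3, h20, h21, e1, e2]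
    omega
  · refine (mergeLoop_spec (lo := lo) (mid := min (lo + w) n) (hi := min (lo + 2 * w) n)
      ?_ ?_ ?_ ?_ ?_ ?_ (by omega) (by omega) (by omega) ?_).frame.mono ?_
    · simp [h3]
    · simp [h21, h3]
    · simp [h0, h3, h20, h21, e1]
    · simp [h21, h3]
    · simp [h0, h20, h21, e1]
    · simp [h0, h20, h21, e1, e2]
    · intro k _ hk
      exact hA k (by omega)
    · rintro t s' ⟨⟨ht, hs, hp⟩, hf⟩
      have e23 : s'.wreg 23 = min (lo + 2 * w) n :=
        (hf.wreg 23 rfl).trans (by simp [h0, h20, h21, e1, e2])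
      have e3 : s'.wreg 3 = 1 := (hf.wreg 3 rfl).trans (by simp [h3])
      refine .block ?_ ⟨?_, ?_, hs, hp⟩
      · simp [e23, e3]; omega
      · simp only [List.length]; omega
      · simp [e23, e3]

theorem copyBack_spec {w : ℕ} (h0 : s.wreg 0 = n) (h3 : s.wreg 3 = 1) (h20 : s.wreg 20 = w)
    (hw : w < n) (hW : 2 * n < W) (hB : ∀ k < n, s.wmem 2 k < W) :
    WP W copyBack (fun t s' => t ≤ n * 4 + 3 ∧ s'.wreg 20 = 2 * w ∧
      ∀ k < n, s'.wmem 1 k = s.wmem 2 k) s := by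
  refine .seq (.block (by simp; omega) (.seq ?_))
  refine (WP.forLoop (N := n) (C := 2) (fun k s' => ∀ q < k, s'.wmem 1 q = s.wmem 2 q)
    (by simp) (by simpa using h0) (by simpa using h3) rfl rfl rfl (by decide) (by decide)
    (by omega) (by simp) ?_).mono ?_
  · intro k s' hk hf hi hI
    have e2 : s'.wmem 2 = s.wmem 2 := hf.wmem 2 rfl
    refine .block ?_ ⟨le_rfl, ?_⟩
    · simp [hi, e2, hB k hk]
    · intro q hq
      rcases Nat.lt_succ_iff_lt_or_eq.mp hq with hq | rfl
      · simp [hi, hI q hq, hq.ne]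
      · simp [hi, e2]
  · rintro t s' ⟨hf, hI, hi, ht⟩
    have e20 : s'.wreg 20 = w := (hf.wreg 20 rfl).trans (by simpa using h20)
    refine .block ?_ ⟨?_, ?_, ?_⟩
    · simp [e20]; omega
    · simp only [List.length]; omega
    · simp [e20]; omega
    · simpa using hI

/-- The restrictions of `f` to the blocks of length `w` of `[0, m)` are sorted by `κ`. -/
def BlockSorted (κ : ℕ → ℝ) (w m : ℕ) (f : ℕ → ℕ) : Prop :=
  ∀ p q, p < q → q < m → p / w = q / w → κ (f p) ≤ κ (f q)

/-- The two inputs are the blocks `2 * b` and `2 * b + 1` of width `w`, cut off at `n`, and their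
merge is block `b` of width `2 * w`. Two positions in the same wide block lie either both before it,
where `hB` applies, or both in it. -/
theorem BlockSorted.merge {κ : ℕ → ℝ} {w b : ℕ} {A B : ℕ → ℕ}
    (hA : BlockSorted κ w n A)
    (hB : BlockSorted κ (2 * w) (b * (2 * w)) B)
    (h : slice B (b * (2 * w)) (min (b * (2 * w) + 2 * w) n) =
        (slice A (b * (2 * w)) (min (b * (2 * w) + w) n)).merge
          (slice A (min (b * (2 * w) + w) n) (min (b * (2 * w) + 2 * w) n)) (keyLE κ)) :
    BlockSorted κ (2 * w) (min (b * (2 * w) + 2 * w) n) B := by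
  have e1 : b * (2 * w) = (2 * b) * w := by ring
  have sl : (slice A (b * (2 * w)) (min (b * (2 * w) + w) n)).Pairwise
      (fun i j => keyLE κ i j = true) := by
    rw [pairwise_slice]
    intro p q hp hpq hq
    simp only [keyLE, decide_eq_true_eq]
    refine hA p q hpq (by omega) ?_
    rw [Nat.div_eq_of_lt_le (m := p) (n := w) (k := 2 * b) (by rw [← e1]; omega)
        (by rw [Nat.succ_mul, ← e1]; omega),
      Nat.div_eq_of_lt_le (m := q) (n := w) (k := 2 * b) (by rw [← e1]; omega)
        (by rw [Nat.succ_mul, ← e1]; omega)]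
  have sr : (slice A (min (b * (2 * w) + w) n) (min (b * (2 * w) + 2 * w) n)).Pairwise
      (fun i j => keyLE κ i j = true) := by
    rw [pairwise_slice]
    intro p q hp hpq hq
    simp only [keyLE, decide_eq_true_eq]
    have e2 : (2 * b + 1) * w = b * (2 * w) + w := by ring
    refine hA p q hpq (by omega) ?_
    rw [Nat.div_eq_of_lt_le (m := p) (n := w) (k := 2 * b + 1) (by rw [e2]; omega)
        (by rw [Nat.succ_mul, e2]; omega),
      Nat.div_eq_of_lt_le (m := q) (n := w) (k := 2 * b + 1) (by rw [e2]; omega)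
        (by rw [Nat.succ_mul, e2]; omega)]
  have sm := List.pairwise_merge (le := keyLE κ)
    (by intro a b c hab hbc
        simp only [keyLE, decide_eq_true_eq] at *
        exact hab.trans hbc)
    (by intro a b
        simp only [keyLE, Bool.or_eq_true, decide_eq_true_eq]
        exact le_total _ _) _ _ sl sr
  rw [← h, pairwise_slice] at sm
  intro p q hpq hq hdiv
  by_cases hq' : q < b * (2 * w)
  · exact hB p q hpq hq' hdiv
  · have hqb : q / (2 * w) = b :=
      Nat.div_eq_of_lt_le (by omega) (by rw [Nat.succ_mul]; omega)
    have hp : b * (2 * w) ≤ p := by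
      rw [hqb] at hdiv
      have := Nat.div_mul_le_self p (2 * w)
      rwa [hdiv] at this
    simpa [keyLE] using sm p q hp hpq hq

theorem mergePass_spec {w : ℕ} (h0 : s.wreg 0 = n) (h3 : s.wreg 3 = 1) (h20 : s.wreg 20 = w)
    (hw0 : 0 < w) (hw : w < n) (hW : 2 * n < W)
    (hperm : (slice (s.wmem 1) 0 n).Perm (List.range n))
    (hsort : BlockSorted (s.rmem 2) w n (s.wmem 1)) :
    WP W mergePass (fun t s' => t ≤ n * 29 + 5 ∧ s'.wreg 20 = 2 * w ∧
      (slice (s'.wmem 1) 0 n).Perm (List.range n) ∧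
      BlockSorted (s.rmem 2) (2 * w) n (s'.wmem 1)) s := by
  have hA : ∀ k < n, s.wmem 1 k < W := by
    intro k hk
    have : s.wmem 1 k ∈ List.range n := hperm.subset (mem_slice.mpr ⟨k, Nat.zero_le _, hk, rfl⟩)
    rw [List.mem_range] at this
    omega
  refine .seq (.block (by simp; omega) (.seq ?_))
  -- A merge of d entries costs at most 13 d + 12 with its test. Since d is at least 1, the fixed
  -- part is charged to the entries: 25 per entry.
  refine (WP.while_frame (fun s' => ∃ b, s'.wreg 21 = min (b * (2 * w)) n ∧
    (slice (s'.wmem 2) 0 (s'.wreg 21)).Perm (slice (s.wmem 1) 0 (s'.wreg 21)) ∧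
    BlockSorted (s.rmem 2) (2 * w) (s'.wreg 21) (s'.wmem 2)) (fun s' => (n - s'.wreg 21) * 25)
    ?_ ?_).mono ?_
  · rintro s' hf ⟨b, h21, hp, hs⟩ hb
    have e0 : s'.wreg 0 = n := (hf.wreg 0 rfl).trans (by simpa using h0)
    have e3 : s'.wreg 3 = 1 := (hf.wreg 3 rfl).trans (by simpa using h3)
    have e20 : s'.wreg 20 = w := (hf.wreg 20 rfl).trans (by simpa using h20)
    have eA : s'.wmem 1 = s.wmem 1 := hf.wmem 1 rfl
    have eK : s'.rmem 2 = s.rmem 2 := hf.rmem 2 rfl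
    simp only [Test.Holds, e0] at hb
    have hlo : s'.wreg 21 = b * (2 * w) := by omega
    rw [hlo] at hb hp hs
    refine (mergeBlocks_spec e0 e3 e20 hlo hb hw hW (by rwa [eA])).mono ?_
    rintro t s'' ⟨ht, h21', hm, hpre⟩
    rw [eA, eK] at hm
    have hcongr : slice (s''.wmem 2) 0 (b * (2 * w)) = slice (s'.wmem 2) 0 (b * (2 * w)) :=
      slice_congr fun k _ hk => hpre k hk
    refine ⟨⟨b + 1, ?_, ?_, ?_⟩, ?_⟩
    · rw [h21', add_mul, one_mul]
    · rw [h21', ← slice_append _ (Nat.zero_le _) (show b * (2 * w) ≤ _ by omega),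
        ← slice_append (s.wmem 1) (Nat.zero_le _) (show b * (2 * w) ≤ _ by omega), hcongr, hm,
        ← slice_append (s.wmem 1) (show b * (2 * w) ≤ min (b * (2 * w) + w) n by omega)
          (show _ ≤ min (b * (2 * w) + 2 * w) n by omega)]
      exact hp.append (List.merge_perm_append _)
    · rw [h21']
      refine hsort.merge ?_ hm
      intro p q hpq hq hd
      rw [hpre p (by omega), hpre q hq]
      exact hs p q hpq hq hd
    · rw [h21', hlo]
      omega
  · refine ⟨0, by simp, by simp [slice_self], ?_⟩
    intro p q _ hq
    simp at hq
  · rintro t s' ⟨hf, ⟨b, h21, hp, hs⟩, hb, ht⟩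
    have e0 : s'.wreg 0 = n := (hf.wreg 0 rfl).trans (by simpa using h0)
    have e3 : s'.wreg 3 = 1 := (hf.wreg 3 rfl).trans (by simpa using h3)
    have e20 : s'.wreg 20 = w := (hf.wreg 20 rfl).trans (by simpa using h20)
    simp only [Test.Holds, e0] at hb
    have hn : s'.wreg 21 = n := by omega
    rw [hn] at hp hs
    have hp' := hp.trans hperm
    refine (copyBack_spec e0 e3 e20 hw hW ?_).mono ?_
    · intro k hk
      have : s'.wmem 2 k ∈ List.range n := hp'.subset (mem_slice.mpr ⟨k, Nat.zero_le _, hk, rfl⟩)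
      rw [List.mem_range] at this
      omega
    · rintro t' s'' ⟨ht', h20', hc⟩
      refine ⟨?_, h20', ?_, ?_⟩
      · simp at ht
        simp only [List.length]
        omega
      · rwa [slice_congr fun k _ hk => hc k hk]
      · intro p q hpq hq hd
        rw [hc p (by omega), hc q hq]
        exact hs p q hpq hq hd

theorem mergeSort_spec (h0 : s.wreg 0 = n) (h3 : s.wreg 3 = 1) (h1W : 1 < W) (hW : 2 * n < W)
    (hperm : (slice (s.wmem 1) 0 n).Perm (List.range n)) :
    WP W mergeSort (fun t s' => t ≤ Nat.clog 2 n * (n * 29 + 6) + 2 ∧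
      (slice (s'.wmem 1) 0 n).Perm (List.range n) ∧
      ∀ p q, p < q → q < n → s.rmem 2 (s'.wmem 1 p) ≤ s.rmem 2 (s'.wmem 1 q)) s := by
  refine .seq (.block (by simpa using h1W) ?_)
  -- The width is always a power of two, so its logarithm counts the completed passes. A width of at
  -- least `n` puts all positions into block 0.
  refine (WP.while_frame (fun s' => s'.wreg 20 = 2 ^ Nat.log 2 (s'.wreg 20) ∧
    (slice (s'.wmem 1) 0 n).Perm (List.range n) ∧
    BlockSorted (s.rmem 2) (s'.wreg 20) n (s'.wmem 1))
    (fun s' => (Nat.clog 2 n - Nat.log 2 (s'.wreg 20)) * (n * 29 + 6)) ?_ ?_).mono ?_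
  · rintro s' hf ⟨h20, hp, hs⟩ hb
    have e0 : s'.wreg 0 = n := (hf.wreg 0 rfl).trans (by simpa using h0)
    have e3 : s'.wreg 3 = 1 := (hf.wreg 3 rfl).trans (by simpa using h3)
    have eK : s'.rmem 2 = s.rmem 2 := hf.rmem 2 rfl
    simp only [Test.Holds, e0] at hb
    refine (mergePass_spec e0 e3 rfl (by rw [h20]; positivity) hb hW hp (by rwa [eK])).mono ?_
    rintro t s'' ⟨ht, h20', hp', hs'⟩
    have hlog : Nat.log 2 (s''.wreg 20) = Nat.log 2 (s'.wreg 20) + 1 := by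
      rw [h20', h20, ← pow_succ', Nat.log_pow (by norm_num), Nat.log_pow (by norm_num)]
    refine ⟨⟨?_, hp', by rw [h20', ← eK]; exact hs'⟩, ?_⟩
    · rw [hlog, pow_succ', ← h20, h20']
    · have hlt : Nat.log 2 (s'.wreg 20) < Nat.clog 2 n := by
        rw [h20] at hb
        exact (Nat.lt_clog_iff_pow_lt (by norm_num)).mpr hb
      obtain ⟨r, hr⟩ := Nat.exists_eq_add_of_lt hlt
      rw [hlog, show Nat.clog 2 n - (Nat.log 2 (s'.wreg 20) + 1) = r by omega,
        show Nat.clog 2 n - Nat.log 2 (s'.wreg 20) = r + 1 by omega]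
      nlinarith
  · refine ⟨by simp, by simpa using hperm, ?_⟩
    intro p q hpq hq hd
    simp at hd
    omega
  · rintro t s' ⟨hf, ⟨h20, hp, hs⟩, hb, ht⟩
    have e0 : s'.wreg 0 = n := (hf.wreg 0 rfl).trans (by simpa using h0)
    simp only [Test.Holds, e0] at hb
    refine ⟨?_, hp, fun p q hpq hq => hs p q hpq hq ?_⟩
    · simp at ht
      simp only [List.length]
      omega
    · rw [Nat.div_eq_of_lt (by omega), Nat.div_eq_of_lt (by omega)]

end RealRAM

namespace RealRAM

/-! ### Slope keys and the program. -/

open Classical in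
/-- `0` if `u` comes before `v` in the lexicographic order of the points, else `1`. -/
noncomputable def lexBit (x y : ℕ → ℝ) (v u : ℕ) : ℕ :=
  if x u - x v < 0 ∨ (x u - x v = 0 ∧ y u - y v < 0) then 0 else 1

/-- The first coordinate of the vector from `v` to `u`, reflected into the right half plane. -/
noncomputable def reflX (x y : ℕ → ℝ) (v u : ℕ) : ℝ :=
  if lexBit x y v u = 0 then 0 - (x u - x v) else x u - x v

/-- The second coordinate of the vector from `v` to `u`, reflected into the right half plane. -/
noncomputable def reflY (x y : ℕ → ℝ) (v u : ℕ) : ℝ :=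
  if lexBit x y v u = 0 then 0 - (y u - y v) else y u - y v

/-- A key that sorts the lines through `v` by slope. -/
noncomputable def slopeKey (x y : ℕ → ℝ) (v u : ℕ) : ℝ :=
  reflY x y v u / (reflX x y v u + |reflY x y v u|)

/-- Reflect the vector in real registers `2`, `3`. -/
def reflect : Program := block [.rop .sub 2 4 2, .rop .sub 3 4 3, .wconst 10 0]

/-- Compute the vector from vertex `v` to vertex `u`, reflected into the right half plane. -/
def reflectedVector : Program :=
  .seq (block [.rload 0 0 1, .rload 1 1 1, .rload 2 0 2, .rload 3 1 2, .rop .sub 2 2 0,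
      .rop .sub 3 3 1, .wconst 9 0, .rcast 4 9, .wconst 10 1])
    (.ifThenElse (.rlt 2 4) reflect
      (.ifThenElse (.req 2 4) (.ifThenElse (.rlt 3 4) reflect .skip) .skip))

/-- Compute the key of `u` at `v`. -/
def computeKey : Program :=
  .seq reflectedVector
    (.seq (block [.rop .add 5 3 4])
      (.seq (.ifThenElse (.rlt 5 4) (block [.rop .sub 5 4 5]) .skip)
        (.seq (block [.rop .add 6 2 5])
          (.ifThenElse (.req 6 4) (block [.rop .add 7 4 4]) (block [.rop .div 7 3 6])))))

/-- Compute and store the key of `u` at `v`, and count `u` if it is a neighbour of `v`. -/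
def keyBody : Program :=
  .seq computeKey (block [.rstore 2 2 7, .wstore 3 2 10, .wstore 1 2 2, .wop .add 11 12 2,
    .wload 13 0 11, .wop .mul 14 13 10, .wop .sub 13 13 14, .wop .add 4 4 14, .wop .add 5 5 13])

/-- Process the next line through `v` in the order of slopes. -/
def sweepBody : Program :=
  block [.wload 9 1 2, .wop .add 11 12 9, .wload 13 0 11, .wload 14 3 9, .wop .mul 14 13 14,
    .wop .sub 13 13 14, .wop .sub 4 4 14, .wop .sub 5 5 13, .wstore 4 11 4, .wstore 5 11 5,
    .wop .add 4 4 13, .wop .add 5 5 14]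

/-- For the vertex `v` in register `1`, count the neighbours above and below each line through `v`
and another vertex. -/
def vertexPhase : Program :=
  .seq (block [.wop .mul 12 1 0, .wconst 2 0, .wconst 4 0, .wconst 5 0])
    (.seq (forLoop 2 0 3 keyBody)
      (.seq (block [.wop .add 9 4 5, .wop .sub 10 9 3, .wop .mul 9 9 10, .wop .add 6 6 9])
        (.seq mergeSort
          (.seq (block [.wconst 2 0]) (forLoop 2 0 3 sweepBody)))))

/-- Account for the line through the vertices in registers `1` and `2`. -/
def pairBody : Program :=
  .ifThenElse (.weq 1 2) .skip
    (block [.wop .mul 11 1 0, .wop .add 11 11 2, .wop .mul 12 2 0, .wop .add 12 12 1,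
      .wload 13 4 11, .wload 14 5 11, .wload 15 4 12, .wload 16 5 12,
      .wop .mul 9 13 15, .wop .add 7 7 9, .wop .mul 9 14 16, .wop .add 7 7 9,
      .wop .mul 9 13 16, .wop .add 8 8 9, .wop .mul 9 14 15, .wop .add 8 8 9])

/-- The program that counts the crossings of a geometric graph. -/
def countCrossings : Program :=
  .seq (block [.wconst 3 1])
    (.seq (forLoop 1 0 3 vertexPhase)
      (.seq (block [.wconst 1 0])
        (.seq (forLoop 1 0 3 (.seq (block [.wconst 2 0]) (forLoop 2 0 3 pairBody)))
          (block [.wop .sub 9 7 8, .wop .sub 9 9 6, .wconst 10 8, .wop .div 0 9 10]))))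

/-! ### Computing keys, and sums in sorted order. -/

/-- The state holds the graph with adjacency matrix `a` and coordinates `x`, `y`. -/
structure Holds (n : ℕ) (a : ℕ → ℕ → ℕ) (x y : ℕ → ℝ) (s : State) : Prop where
  size : s.wreg 0 = n
  one : s.wreg 3 = 1
  adj : ∀ v < n, ∀ u < n, s.wmem 0 (v * n + u) = a v u
  fst : ∀ v < n, s.rmem 0 v = x v
  snd : ∀ v < n, s.rmem 1 v = y v

variable {W n : ℕ} {a : ℕ → ℕ → ℕ} {x y : ℕ → ℝ} {s : State}

theorem Holds.frame {p : Program} {s' : State} (h : Holds n a x y s) (hf : Frame p s s')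
    (h0 : p.any (fun c => c.writesWReg 0) = false) (h3 : p.any (fun c => c.writesWReg 3) = false)
    (hm : p.any (fun c => c.writesWMem 0) = false) (hr0 : p.any (fun c => c.writesRMem 0) = false)
    (hr1 : p.any (fun c => c.writesRMem 1) = false) : Holds n a x y s' where
  size := (hf.wreg 0 h0).trans h.size
  one := (hf.wreg 3 h3).trans h.one
  adj := by rw [hf.wmem 0 hm]; exact h.adj
  fst := by rw [hf.rmem 0 hr0]; exact h.fst
  snd := by rw [hf.rmem 1 hr1]; exact h.snd

theorem effects_frame {l : List Instr} (hl : Oks W l s) : Frame (block l) s (effects l s) := by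
  obtain ⟨t, s', hr, rfl⟩ := WP.block (Q := fun _ s' => s' = effects l s) hl rfl
  exact hr.frame

theorem reflectedVector_spec {v u : ℕ} (hs : Holds n a x y s) (h1 : s.wreg 1 = v)
    (h2 : s.wreg 2 = u) (hv : v < n) (hu : u < n) (hW : 1 < W) :
    WP W reflectedVector (fun t s' => t ≤ 15 ∧ s'.rreg 2 = reflX x y v u ∧
      s'.rreg 3 = reflY x y v u ∧ s'.rreg 4 = 0 ∧ s'.wreg 10 = lexBit x y v u) s := by
  have hdone : ∀ s' : State, s'.rreg 2 = x u - x v → s'.rreg 3 = y u - y v → s'.rreg 4 = 0 →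
      s'.wreg 10 = 1 → lexBit x y v u = 1 → WP W .skip (fun t s' => t = 0 ∧
        s'.rreg 2 = reflX x y v u ∧ s'.rreg 3 = reflY x y v u ∧ s'.rreg 4 = 0 ∧
        s'.wreg 10 = lexBit x y v u) s' := by
    intro s' e2 e3 e4 e10 hb
    exact .skip ⟨rfl, by simp [reflX, hb, e2], by simp [reflY, hb, e3], e4, by rw [e10, hb]⟩
  have hrefl : ∀ s' : State, s'.rreg 2 = x u - x v → s'.rreg 3 = y u - y v → s'.rreg 4 = 0 →
      lexBit x y v u = 0 → WP W reflect (fun t s' => t = 3 ∧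
        s'.rreg 2 = reflX x y v u ∧ s'.rreg 3 = reflY x y v u ∧ s'.rreg 4 = 0 ∧
        s'.wreg 10 = lexBit x y v u) s' := by
    intro s' e2 e3 e4 hb
    refine .block (by simp; omega) ⟨rfl, ?_, ?_, ?_, ?_⟩ <;> simp [reflX, reflY, hb, e2, e3, e4]
  refine .seq (.block (by simp; omega) ?_)
  set s₁ := effects _ s with hs₁
  have e2 : s₁.rreg 2 = x u - x v := by simp [hs₁, h1, h2, hs.fst, hu, hv]
  have e3 : s₁.rreg 3 = y u - y v := by simp [hs₁, h1, h2, hs.snd, hu, hv]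
  have e4 : s₁.rreg 4 = 0 := by simp [hs₁]
  have e10 : s₁.wreg 10 = 1 := by simp [hs₁]
  clear_value s₁
  refine .ite ?_ ?_
  · intro hb
    simp only [Test.Holds, e2, e4] at hb
    refine (hrefl _ e2 e3 e4 (by simp [lexBit, hb])).mono fun t s' ⟨ht, h⟩ => ⟨?_, h⟩
    simp [ht]
  · intro hb
    simp only [Test.Holds, e2, e4] at hb
    refine .ite ?_ ?_
    · intro hb2
      simp only [Test.Holds, e2, e4] at hb2
      refine .ite ?_ ?_
      · intro hb3
        simp only [Test.Holds, e3, e4] at hb3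
        refine (hrefl _ e2 e3 e4 (by simp only [lexBit, hb2, hb3]; simp)).mono
          fun t s' ⟨ht, h⟩ => ⟨?_, h⟩
        simp [ht]
      · intro hb3
        simp only [Test.Holds, e3, e4] at hb3
        refine (hdone _ e2 e3 e4 e10 ?_).mono fun t s' ⟨ht, h⟩ => ⟨?_, h⟩
        · exact if_neg (by tauto)
        · simp [ht]
    · intro hb2
      simp only [Test.Holds, e2, e4] at hb2
      refine (hdone _ e2 e3 e4 e10 ?_).mono fun t s' ⟨ht, h⟩ => ⟨?_, h⟩
      · exact if_neg (by tauto)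
      · simp [ht]

theorem computeKey_spec {v u : ℕ} (hs : Holds n a x y s) (h1 : s.wreg 1 = v)
    (h2 : s.wreg 2 = u) (hv : v < n) (hu : u < n) (hW : 1 < W) :
    WP W computeKey (fun t s' => t ≤ 25 ∧ s'.rreg 7 = slopeKey x y v u ∧
      s'.wreg 10 = lexBit x y v u) s := by
  refine .seq ((reflectedVector_spec hs h1 h2 hv hu hW).mono ?_)
  rintro t s₁ ⟨ht, e2, e3, e4, e10⟩
  refine .seq (.block (by simp) (.seq ?_))
  have habs : WP W (.ifThenElse (.rlt 5 4) (block [.rop .sub 5 4 5]) .skip)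
      (fun t s' => t ≤ 2 ∧ s'.rreg 2 = reflX x y v u ∧ s'.rreg 3 = reflY x y v u ∧
        s'.rreg 4 = 0 ∧ s'.rreg 5 = |reflY x y v u| ∧ s'.wreg 10 = lexBit x y v u)
      (effects [.rop .add 5 3 4] s₁) := by
    refine .ite ?_ ?_
    · intro hb
      simp [Test.Holds, e3, e4] at hb
      refine .block (by simp) ⟨by simp, ?_⟩
      simp [e2, e3, e4, e10, abs_of_neg hb]
    · intro hb
      simp [Test.Holds, e3, e4] at hb
      refine .skip ⟨by simp, ?_⟩
      simp [e2, e3, e4, e10, abs_of_nonneg hb]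
  refine habs.mono ?_
  rintro t' s₂ ⟨ht', f2, f3, f4, f5, f10⟩
  refine .seq (.block (by simp) (.ite ?_ ?_))
  -- The machine cannot divide by zero, so it writes 0 here, which is the value that `slopeKey` has
  -- by the convention for division by zero. On geometric input this happens only for u = v.
  · intro hb
    simp [Test.Holds, f2, f4, f5] at hb
    refine .block (by simp) ⟨?_, ?_, ?_⟩
    · simp only [List.length]; omega
    · simp [f4, slopeKey, hb]
    · simpa using f10
  · intro hb
    simp [Test.Holds, f2, f4, f5] at hb
    refine .block (by simpa [f2, f5] using hb) ⟨?_, ?_, ?_⟩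
    · simp only [List.length]; omega
    · simp [f2, f3, f5, slopeKey]
    · simpa using f10

theorem lexBit_le_one (x y : ℕ → ℝ) (v u : ℕ) : lexBit x y v u ≤ 1 := by
  unfold lexBit; split_ifs <;> simp

/-- Whether `u` is a neighbour of `v` that comes after `v`. -/
noncomputable def nbrPos (a : ℕ → ℕ → ℕ) (x y : ℕ → ℝ) (v u : ℕ) : ℕ := a v u * lexBit x y v u

/-- Whether `u` is a neighbour of `v` that comes before `v`. -/
noncomputable def nbrNeg (a : ℕ → ℕ → ℕ) (x y : ℕ → ℝ) (v u : ℕ) : ℕ :=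
  a v u - a v u * lexBit x y v u

theorem nbrPos_add_nbrNeg (a : ℕ → ℕ → ℕ) (x y : ℕ → ℝ) (v u : ℕ) :
    nbrPos a x y v u + nbrNeg a x y v u = a v u := by
  have := Nat.mul_le_mul_left (a v u) (lexBit_le_one x y v u)
  unfold nbrPos nbrNeg
  omega

theorem mul_add_lt_mul {v u : ℕ} (hv : v < n) (hu : u < n) : v * n + u < n * n := by
  have : (v + 1) * n ≤ n * n := Nat.mul_le_mul_right _ hv
  rw [Nat.succ_mul] at this
  omega

theorem keyBody_spec {v u : ℕ} (hs : Holds n a x y s) (h1 : s.wreg 1 = v)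
    (h2 : s.wreg 2 = u) (h12 : s.wreg 12 = v * n) (hv : v < n) (hu : u < n)
    (ha : a v u ≤ 1) (hW : n * n + 2 < W) (h4 : s.wreg 4 ≤ n) (h5 : s.wreg 5 ≤ n) :
    WP W keyBody (fun t s' => t ≤ 34 ∧
      s'.rmem 2 = Function.update (s.rmem 2) u (slopeKey x y v u) ∧
      s'.wmem 3 = Function.update (s.wmem 3) u (lexBit x y v u) ∧
      s'.wmem 1 = Function.update (s.wmem 1) u u ∧
      s'.wreg 4 = s.wreg 4 + nbrPos a x y v u ∧ s'.wreg 5 = s.wreg 5 + nbrNeg a x y v u) s := by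
  refine .seq ((computeKey_spec hs h1 h2 hv hu (by omega)).frame.mono ?_)
  rintro t s₁ ⟨⟨ht, e7, e10⟩, hf⟩
  have hs₁ := hs.frame hf rfl rfl rfl rfl rfl
  have f2 : s₁.wreg 2 = u := (hf.wreg 2 rfl).trans h2
  have f12 : s₁.wreg 12 = v * n := (hf.wreg 12 rfl).trans h12
  have f4 : s₁.wreg 4 = s.wreg 4 := hf.wreg 4 rfl
  have f5 : s₁.wreg 5 = s.wreg 5 := hf.wreg 5 rfl
  have g2 : s₁.rmem 2 = s.rmem 2 := hf.rmem 2 rfl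
  have g3 : s₁.wmem 3 = s.wmem 3 := hf.wmem 3 rfl
  have g1 : s₁.wmem 1 = s.wmem 1 := hf.wmem 1 rfl
  have hidx := mul_add_lt_mul hv hu
  have hn : n ≤ n * n := Nat.le_mul_self n
  have hp := nbrPos_add_nbrNeg a x y v u
  have hp1 : nbrPos a x y v u = a v u * lexBit x y v u := rfl
  have hp2 : nbrNeg a x y v u = a v u - a v u * lexBit x y v u := rfl
  refine .block ?_ ⟨?_, ?_, ?_, ?_, ?_, ?_⟩
  · simp [f2, f12, f4, f5, e10, hs₁.adj v hv u hu]
    rw [← hp1]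
    omega
  · simp only [List.length]; omega
  · ext m; simp [f2, e7, g2, Function.update_apply]
  · ext m; simp [f2, e10, g3, Function.update_apply]
  · ext m; simp [f2, g1, Function.update_apply]
  · simp [f2, f12, f4, e10, hs₁.adj v hv u hu, hp1]
  · simp [f2, f12, f5, e10, hs₁.adj v hv u hu, hp2]

theorem sum_range_comp_of_perm {A : ℕ → ℕ} (hA : (slice A 0 n).Perm (List.range n)) (F : ℕ → ℕ) :
    ∑ j ∈ Finset.range n, F (A j) = ∑ u ∈ Finset.range n, F u := by
  have h := (hA.map F).sum_eq
  rw [slice, List.map_map, Nat.sub_zero, ← List.range_eq_range'] at h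
  exact h

theorem injOn_of_perm {A : ℕ → ℕ} (hA : (slice A 0 n).Perm (List.range n)) {i j : ℕ}
    (hij : i < j) (hj : j < n) : A i ≠ A j := by
  have h : (slice A 0 n).Nodup := hA.nodup_iff.mpr List.nodup_range
  exact pairwise_slice.mp h i j (Nat.zero_le _) hij hj

/-- In sorted order, prefix and suffix sums are sums over smaller and larger keys. -/
theorem sum_prefix_add_sum_suffix {A : ℕ → ℕ} {κ : ℕ → ℝ} {p q : ℕ → ℕ} {k : ℕ}
    (hA : (slice A 0 n).Perm (List.range n))
    (hsort : ∀ i j, i < j → j < n → κ (A i) ≤ κ (A j)) (hk : k < n)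
    (htie : ∀ u < n, u ≠ A k → κ u = κ (A k) → p u = 0 ∧ q u = 0) :
    ∑ j ∈ Finset.range k, q (A j) + ∑ j ∈ Finset.Ico (k + 1) n, p (A j) =
      ∑ u ∈ Finset.range n, if u = A k then 0 else if κ (A k) < κ u then p u else q u := by
  have hAn : ∀ j < n, A j < n := fun j hj =>
    List.mem_range.mp (hA.subset (mem_slice.mpr ⟨j, Nat.zero_le _, hj, rfl⟩))
  rw [← sum_range_comp_of_perm hA, ← Finset.sum_range_add_sum_Ico _ hk.le,
    Finset.sum_eq_sum_Ico_succ_bot hk, if_pos rfl, zero_add]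
  congr 1
  · refine Finset.sum_congr rfl fun j hj => ?_
    rw [Finset.mem_range] at hj
    rw [if_neg (injOn_of_perm hA hj hk), if_neg (not_lt.mpr (hsort j k hj hk))]
  · refine Finset.sum_congr rfl fun j hj => ?_
    rw [Finset.mem_Ico] at hj
    have hne := (injOn_of_perm hA (Nat.lt_of_succ_le hj.1) hj.2).symm
    rw [if_neg hne]
    -- A later entry with an equal key falls into the `q` branch of the conditional although the
    -- suffix contributes `p`; for such ties both are 0.
    rcases (hsort k j (Nat.lt_of_succ_le hj.1) hj.2).lt_or_eq with h | h
    · rw [if_pos h]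
    · have := htie (A j) (hAn j hj.2) hne h.symm
      rw [if_neg h.not_lt, this.1, this.2]

end RealRAM

namespace RealRAM
variable {W n : ℕ} {a : ℕ → ℕ → ℕ} {x y : ℕ → ℝ} {s : State}

/-! ### The sweep around one vertex. -/

/-- The number of neighbours of `v` above the line through `v` and `w`. -/
noncomputable def nbrsAbove (n : ℕ) (a : ℕ → ℕ → ℕ) (x y : ℕ → ℝ) (v w : ℕ) : ℕ :=
  open Classical in ∑ u ∈ Finset.range n, if u = w then 0 else
    if slopeKey x y v w < slopeKey x y v u then nbrPos a x y v u else nbrNeg a x y v u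

/-- The number of neighbours of `v` below the line through `v` and `w`. -/
noncomputable def nbrsBelow (n : ℕ) (a : ℕ → ℕ → ℕ) (x y : ℕ → ℝ) (v w : ℕ) : ℕ :=
  open Classical in ∑ u ∈ Finset.range n, if u = w then 0 else
    if slopeKey x y v w < slopeKey x y v u then nbrNeg a x y v u else nbrPos a x y v u

theorem sum_le_of_le_one {f : ℕ → ℕ} {S : Finset ℕ} (hS : S ⊆ Finset.range n)
    (hf : ∀ j ∈ S, f j ≤ 1) : ∑ j ∈ S, f j ≤ n := by
  have h1 := Finset.sum_le_card_nsmul S f 1 hf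
  have h2 := Finset.card_le_card hS
  rw [Finset.card_range] at h2
  rw [smul_eq_mul, mul_one] at h1
  exact h1.trans h2

theorem keyLoop_spec {v : ℕ} (hs : Holds n a x y s) (h1 : s.wreg 1 = v) (h2 : s.wreg 2 = 0)
    (h4 : s.wreg 4 = 0) (h5 : s.wreg 5 = 0) (h12 : s.wreg 12 = v * n) (hv : v < n)
    (ha : ∀ u < n, a v u ≤ 1) (hW : n * n + 2 < W) :
    WP W (forLoop 2 0 3 keyBody) (fun t s' => t ≤ n * 36 + 1 ∧
      (∀ u < n, s'.rmem 2 u = slopeKey x y v u ∧ s'.wmem 3 u = lexBit x y v u ∧ s'.wmem 1 u = u) ∧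
      s'.wreg 4 = ∑ u ∈ Finset.range n, nbrPos a x y v u ∧
      s'.wreg 5 = ∑ u ∈ Finset.range n, nbrNeg a x y v u) s := by
  have hn : n ≤ n * n := Nat.le_mul_self n
  have hsum := fun u => nbrPos_add_nbrNeg a x y v u
  refine (WP.forLoop (N := n) (C := 34) (fun k s' =>
      (∀ u < k, s'.rmem 2 u = slopeKey x y v u ∧ s'.wmem 3 u = lexBit x y v u ∧ s'.wmem 1 u = u) ∧
      s'.wreg 4 = ∑ u ∈ Finset.range k, nbrPos a x y v u ∧
      s'.wreg 5 = ∑ u ∈ Finset.range k, nbrNeg a x y v u)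
    h2 hs.size hs.one rfl rfl rfl (by decide) (by decide) (by omega) (by simp [h4, h5]) ?_).mono ?_
  · rintro k s' hk hf hi ⟨hI, h4', h5'⟩
    have hsub : Finset.range k ⊆ Finset.range n := Finset.range_subset_range.mpr hk.le
    refine (keyBody_spec (hs.frame hf rfl rfl rfl rfl rfl) ((hf.wreg 1 rfl).trans h1) hi
      ((hf.wreg 12 rfl).trans h12) hv hk (ha k hk) hW ?_ ?_).mono ?_
    · rw [h4']
      refine sum_le_of_le_one hsub fun j hj => ?_
      have := ha j (Finset.mem_range.mp (hsub hj))
      have := hsum j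
      omega
    · rw [h5']
      refine sum_le_of_le_one hsub fun j hj => ?_
      have := ha j (Finset.mem_range.mp (hsub hj))
      have := hsum j
      omega
    · rintro t s'' ⟨ht, hr2, hm3, hm1, e4, e5⟩
      refine ⟨ht, ?_, ?_, ?_⟩
      · intro u hu
        rcases Nat.lt_succ_iff_lt_or_eq.mp hu with hu | rfl
        · simp only [putWord_rmem, putWord_wmem, hr2, hm3, hm1, Function.update_of_ne hu.ne]
          exact hI u hu
        · simp [hr2, hm3, hm1]
      · simp [e4, h4', Finset.sum_range_succ]
      · simp [e5, h5', Finset.sum_range_succ]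
  · rintro t s' ⟨hf, ⟨hI, h4', h5'⟩, hi, ht⟩
    exact ⟨ht, hI, h4', h5'⟩

/-- Before step k, the neighbours above the line are the left ones among the first k entries and the
right ones among the others; below the line it is the reverse. The counts are stored after the
current vertex has been removed from its old side and before it joins the new one, so it counts for
neither. The entry for w = v is meaningless and never used; the last clause protects the rows of
earlier vertices. -/
theorem sweepLoop_spec {v : ℕ} (hs : Holds n a x y s) (h2 : s.wreg 2 = 0)
    (h12 : s.wreg 12 = v * n) (hv : v < n)
    (h4 : s.wreg 4 = ∑ u ∈ Finset.range n, nbrPos a x y v u)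
    (h5 : s.wreg 5 = ∑ u ∈ Finset.range n, nbrNeg a x y v u)
    (hbit : ∀ u < n, s.wmem 3 u = lexBit x y v u)
    (hperm : (slice (s.wmem 1) 0 n).Perm (List.range n))
    (hsort : ∀ i j, i < j → j < n → slopeKey x y v (s.wmem 1 i) ≤ slopeKey x y v (s.wmem 1 j))
    (htie : ∀ w < n, w ≠ v → ∀ u < n, u ≠ w → slopeKey x y v u = slopeKey x y v w → a v u = 0)
    (ha : ∀ u < n, a v u ≤ 1) (hW : n * n + 2 < W) :
    WP W (forLoop 2 0 3 sweepBody) (fun t s' => t ≤ n * 14 + 1 ∧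
      (∀ w < n, w ≠ v → s'.wmem 4 (v * n + w) = nbrsAbove n a x y v w ∧
        s'.wmem 5 (v * n + w) = nbrsBelow n a x y v w) ∧
      ∀ i < v * n, s'.wmem 4 i = s.wmem 4 i ∧ s'.wmem 5 i = s.wmem 5 i) s := by
  classical
  have hn : n ≤ n * n := Nat.le_mul_self n
  have hsum := fun u => nbrPos_add_nbrNeg a x y v u
  set A := s.wmem 1 with hA
  set p := nbrPos a x y v with hp
  set q := nbrNeg a x y v with hq
  have hAn : ∀ j < n, A j < n := fun j hj =>
    List.mem_range.mp (hperm.subset (mem_slice.mpr ⟨j, Nat.zero_le _, hj, rfl⟩))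
  have hle : ∀ j < n, p (A j) + q (A j) ≤ 1 := fun j hj => by
    rw [hp, hq, hsum]; exact ha _ (hAn j hj)
  -- Every neighbour is counted on one side only, so the two registers together never exceed `n`;
  -- this rules out overflow.
  have htot : ∀ k ≤ n, (∑ j ∈ Finset.range k, q (A j) + ∑ j ∈ Finset.Ico k n, p (A j)) +
      (∑ j ∈ Finset.range k, p (A j) + ∑ j ∈ Finset.Ico k n, q (A j)) ≤ n := by
    intro k hk
    have e : ∀ f : ℕ → ℕ, ∑ j ∈ Finset.range k, f j + ∑ j ∈ Finset.Ico k n, f j =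
        ∑ j ∈ Finset.range n, f j := fun f => Finset.sum_range_add_sum_Ico f hk
    have e1 := e (fun j => p (A j))
    have e2 := e (fun j => q (A j))
    have e3 := sum_le_of_le_one (n := n) (f := fun j => p (A j) + q (A j)) subset_rfl
      fun j hj => hle j (Finset.mem_range.mp hj)
    rw [Finset.sum_add_distrib] at e3
    omega
  refine (WP.forLoop (N := n) (C := 12) (fun k s' =>
      s'.wreg 4 = ∑ j ∈ Finset.range k, q (A j) + ∑ j ∈ Finset.Ico k n, p (A j) ∧
      s'.wreg 5 = ∑ j ∈ Finset.range k, p (A j) + ∑ j ∈ Finset.Ico k n, q (A j) ∧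
      (∀ i < k, s'.wmem 4 (v * n + A i) =
          ∑ j ∈ Finset.range i, q (A j) + ∑ j ∈ Finset.Ico (i + 1) n, p (A j) ∧
        s'.wmem 5 (v * n + A i) =
          ∑ j ∈ Finset.range i, p (A j) + ∑ j ∈ Finset.Ico (i + 1) n, q (A j)) ∧
      ∀ i < v * n, s'.wmem 4 i = s.wmem 4 i ∧ s'.wmem 5 i = s.wmem 5 i)
    h2 hs.size hs.one rfl rfl rfl (by decide) (by decide) (by omega) ?_ ?_).mono ?_
  · refine ⟨?_, ?_, by simp, by simp⟩
    · rw [h4, ← sum_range_comp_of_perm hperm]; simp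
    · rw [h5, ← sum_range_comp_of_perm hperm]; simp
  · rintro k s' hk hf hi ⟨h4', h5', hI, hpre⟩
    have hs' := hs.frame hf rfl rfl rfl rfl rfl
    have f12 : s'.wreg 12 = v * n := (hf.wreg 12 rfl).trans h12
    have gA : s'.wmem 1 = A := hf.wmem 1 rfl
    have g3 : s'.wmem 3 (A k) = lexBit x y v (A k) := by
      rw [hf.wmem 3 rfl, hbit _ (hAn k hk)]
    have gadj := hs'.adj v hv (A k) (hAn k hk)
    have hidx := mul_add_lt_mul hv (hAn k hk)
    have ep : a v (A k) * lexBit x y v (A k) = p (A k) := rfl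
    have eq : a v (A k) - p (A k) = q (A k) := rfl
    have hak := ha _ (hAn k hk)
    have hbk := lexBit_le_one x y v (A k)
    have ht0 := htot k hk.le
    have ht1 := htot (k + 1) hk
    have i1 := Finset.sum_eq_sum_Ico_succ_bot hk (fun j => p (A j))
    have i2 := Finset.sum_eq_sum_Ico_succ_bot hk (fun j => q (A j))
    have i3 := Finset.sum_range_succ (fun j => p (A j)) k
    have i4 := Finset.sum_range_succ (fun j => q (A j)) k
    -- The subtraction is not truncated: the k-th term is a summand of the register.
    have o4 : s'.wreg 4 - p (A k) =
        ∑ j ∈ Finset.range k, q (A j) + ∑ j ∈ Finset.Ico (k + 1) n, p (A j) := by omega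
    have o5 : s'.wreg 5 - q (A k) =
        ∑ j ∈ Finset.range k, p (A j) + ∑ j ∈ Finset.Ico (k + 1) n, q (A j) := by omega
    refine .block ?_ ⟨le_rfl, ?_, ?_, ?_, ?_⟩
    · simp [hi, f12, gA, g3, gadj, ep, eq, o4, o5]
      have := hAn k hk
      omega
    · simp [hi, f12, gA, g3, gadj, ep, eq, o4]
      omega
    · simp [hi, f12, gA, g3, gadj, ep, eq, o5]
      omega
    · intro i hik
      rcases Nat.lt_succ_iff_lt_or_eq.mp hik with hik | rfl
      · have := injOn_of_perm hperm hik hk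
        simp [hi, f12, gA, this, hI i hik]
      · simp [hi, f12, gA, g3, gadj, ep, eq, o4, o5]
    · intro i hiv
      have : i ≠ v * n + A k := by omega
      simp [hi, f12, gA, this, hpre i hiv]
  · rintro t s' ⟨hf, ⟨h4', h5', hI, hpre⟩, hi, ht⟩
    refine ⟨ht, fun w hw hwv => ?_, hpre⟩
    have hmem : w ∈ slice A 0 n := hperm.symm.subset (List.mem_range.mpr hw)
    obtain ⟨k, -, hk, rfl⟩ := mem_slice.mp hmem
    have hz : ∀ u < n, u ≠ A k → slopeKey x y v u = slopeKey x y v (A k) → p u = 0 ∧ q u = 0 := by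
      intro u hu hne he
      have h := htie _ hw hwv u hu hne he
      have := hsum u
      rw [h] at this
      constructor <;> omega
    rw [(hI k hk).1, (hI k hk).2, nbrsAbove, nbrsBelow]
    exact ⟨sum_prefix_add_sum_suffix hperm hsort hk hz,
      sum_prefix_add_sum_suffix hperm hsort hk fun u hu hne he => (hz u hu hne he).symm⟩

/-- The degree of `v`. -/
def degree (n : ℕ) (a : ℕ → ℕ → ℕ) (v : ℕ) : ℕ := ∑ u ∈ Finset.range n, a v u

/-- Only the sort takes more than linear time. The bound on `S` leaves room for one more summand of
size at most `n * n` in a word. -/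
theorem vertexPhase_spec {v S : ℕ} (hs : Holds n a x y s) (h1 : s.wreg 1 = v) (hv : v < n)
    (h6 : s.wreg 6 = S) (hS : S ≤ v * (n * n))
    (htie : ∀ w < n, w ≠ v → ∀ u < n, u ≠ w → slopeKey x y v u = slopeKey x y v w → a v u = 0)
    (ha : ∀ u < n, a v u ≤ 1) (hW : n * (n * n) + n * n + 2 * n + 2 < W) :
    WP W vertexPhase (fun t s' => t ≤ Nat.clog 2 n * (n * 29 + 6) + n * 50 + 13 ∧
      s'.wreg 6 = S + degree n a v * (degree n a v - 1) ∧
      (∀ w < n, w ≠ v → s'.wmem 4 (v * n + w) = nbrsAbove n a x y v w ∧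
        s'.wmem 5 (v * n + w) = nbrsBelow n a x y v w) ∧
      ∀ i < v * n, s'.wmem 4 i = s.wmem 4 i ∧ s'.wmem 5 i = s.wmem 5 i) s := by
  have hvn := mul_add_lt_mul hv hv
  have hok : Oks W [.wop .mul 12 1 0, .wconst 2 0, .wconst 4 0, .wconst 5 0] s := by
    simp [h1, hs.size]; omega
  have hf₁ := effects_frame hok
  refine .seq (.block hok (.seq ?_))
  have hs₁ := hs.frame hf₁ rfl rfl rfl rfl rfl
  refine (keyLoop_spec hs₁ (by simpa using h1) (by simp) (by simp) (by simp)
    (by simp [h1, hs.size]) hv ha (by omega)).frame.mono ?_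
  rintro t₂ s₂ ⟨⟨ht₂, hkey, e4, e5⟩, hf₂⟩
  have hs₂ := hs₁.frame hf₂ rfl rfl rfl rfl rfl
  have e6 : s₂.wreg 6 = S := (hf₂.wreg 6 rfl).trans ((hf₁.wreg 6 rfl).trans h6)
  have e12 : s₂.wreg 12 = v * n := (hf₂.wreg 12 rfl).trans (by simp [h1, hs.size])
  have g4 : s₂.wmem 4 = s.wmem 4 := (hf₂.wmem 4 rfl).trans (hf₁.wmem 4 rfl)
  have g5 : s₂.wmem 5 = s.wmem 5 := (hf₂.wmem 5 rfl).trans (hf₁.wmem 5 rfl)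
  have edeg : s₂.wreg 4 + s₂.wreg 5 = degree n a v := by
    rw [e4, e5, ← Finset.sum_add_distrib]
    exact Finset.sum_congr rfl fun u _ => nbrPos_add_nbrNeg a x y v u
  have hdeg : degree n a v ≤ n :=
    sum_le_of_le_one subset_rfl fun u hu => ha u (Finset.mem_range.mp hu)
  have hdd : degree n a v * (degree n a v - 1) ≤ n * n :=
    Nat.mul_le_mul hdeg (by omega)
  have hSn : S + n * n ≤ n * (n * n) := by
    have : (v + 1) * (n * n) ≤ n * (n * n) := Nat.mul_le_mul_right _ hv
    rw [Nat.succ_mul] at this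
    omega
  have hok₃ : Oks W [.wop .add 9 4 5, .wop .sub 10 9 3, .wop .mul 9 9 10, .wop .add 6 6 9] s₂ := by
    simp [edeg, hs₂.one, e6]; omega
  have hf₃ := effects_frame hok₃
  refine .seq (.block hok₃ (.seq ?_))
  have hs₃ := hs₂.frame hf₃ rfl rfl rfl rfl rfl
  have e6' : (effects [.wop .add 9 4 5, .wop .sub 10 9 3, .wop .mul 9 9 10, .wop .add 6 6 9]
      s₂).wreg 6 = S + degree n a v * (degree n a v - 1) := by
    simp [edeg, hs₂.one, e6]
  generalize effects [.wop .add 9 4 5, .wop .sub 10 9 3, .wop .mul 9 9 10, .wop .add 6 6 9]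
    s₂ = s₃ at hf₃ hs₃ e6' ⊢
  refine (mergeSort_spec hs₃.size hs₃.one (by omega) (by omega) ?_).frame.mono ?_
  · rw [hf₃.wmem 1 rfl, slice_congr (g := id) (fun u _ hu => (hkey u hu).2.2), slice, List.map_id,
      Nat.sub_zero, ← List.range_eq_range']
  rintro t₄ s₄ ⟨⟨ht₄, hperm, hsort⟩, hf₄⟩
  have hs₄ := hs₃.frame hf₄ rfl rfl rfl rfl rfl
  have hAn : ∀ j < n, s₄.wmem 1 j < n := fun j hj =>
    List.mem_range.mp (hperm.subset (mem_slice.mpr ⟨j, Nat.zero_le _, hj, rfl⟩))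
  have hok₅ : Oks W [.wconst 2 0] s₄ := by simp; omega
  have hf₅ := effects_frame hok₅
  refine .seq (.block hok₅ ?_)
  refine (sweepLoop_spec (v := v) (hs₄.frame hf₅ rfl rfl rfl rfl rfl) (by simp) ?_ hv ?_ ?_ ?_
    ?_ ?_ htie ha (by omega)).frame.mono ?_
  · rw [hf₅.wreg 12 rfl, hf₄.wreg 12 rfl, hf₃.wreg 12 rfl, e12]
  · rw [hf₅.wreg 4 rfl, hf₄.wreg 4 rfl, hf₃.wreg 4 rfl, e4]
  · rw [hf₅.wreg 5 rfl, hf₄.wreg 5 rfl, hf₃.wreg 5 rfl, e5]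
  · intro u hu
    rw [hf₅.wmem 3 rfl, hf₄.wmem 3 rfl, hf₃.wmem 3 rfl, (hkey u hu).2.1]
  · rwa [hf₅.wmem 1 rfl]
  · intro i j hij hj
    have := hsort i j hij hj
    rw [hf₃.rmem 2 rfl, (hkey _ (hAn i (by omega))).1, (hkey _ (hAn j hj)).1] at this
    rwa [hf₅.wmem 1 rfl]
  · rintro t₆ s₆ ⟨⟨ht₆, hC, hpre⟩, hf₆⟩
    refine ⟨?_, ?_, hC, ?_⟩
    · simp only [List.length]; omega
    · rw [hf₆.wreg 6 rfl, hf₅.wreg 6 rfl, hf₄.wreg 6 rfl, e6']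
    · intro i hi
      rw [(hpre i hi).1, (hpre i hi).2, hf₅.wmem 4 rfl, hf₄.wmem 4 rfl, hf₃.wmem 4 rfl, g4,
        hf₅.wmem 5 rfl, hf₄.wmem 5 rfl, hf₃.wmem 5 rfl, g5]
      exact ⟨rfl, rfl⟩

end RealRAM

namespace RealRAM
variable {W n : ℕ} {a : ℕ → ℕ → ℕ} {x y : ℕ → ℝ} {s : State}

/-! ### Summation over pairs of vertices. -/

/-- The number of pairs of edges at `v` and at `w` on the same side of the line through `v`
and `w`. -/
noncomputable def samePairs (n : ℕ) (a : ℕ → ℕ → ℕ) (x y : ℕ → ℝ) (v w : ℕ) : ℕ :=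
  if v = w then 0 else nbrsAbove n a x y v w * nbrsAbove n a x y w v +
    nbrsBelow n a x y v w * nbrsBelow n a x y w v

/-- The number of pairs of edges at `v` and at `w` on opposite sides of the line through `v`
and `w`. -/
noncomputable def oppositePairs (n : ℕ) (a : ℕ → ℕ → ℕ) (x y : ℕ → ℝ) (v w : ℕ) : ℕ :=
  if v = w then 0 else nbrsAbove n a x y v w * nbrsBelow n a x y w v +
    nbrsBelow n a x y v w * nbrsAbove n a x y w v

theorem nbrsAbove_le {v : ℕ} (w : ℕ) (ha : ∀ u < n, a v u ≤ 1) : nbrsAbove n a x y v w ≤ n := by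
  classical
  refine sum_le_of_le_one subset_rfl fun u hu => ?_
  have := ha u (Finset.mem_range.mp hu)
  have := nbrPos_add_nbrNeg a x y v u
  split_ifs <;> omega

theorem nbrsBelow_le {v : ℕ} (w : ℕ) (ha : ∀ u < n, a v u ≤ 1) : nbrsBelow n a x y v w ≤ n := by
  classical
  refine sum_le_of_le_one subset_rfl fun u hu => ?_
  have := ha u (Finset.mem_range.mp hu)
  have := nbrPos_add_nbrNeg a x y v u
  split_ifs <;> omega

theorem samePairs_le {v w : ℕ} (hv : v < n) (hw : w < n) (ha : ∀ v < n, ∀ u < n, a v u ≤ 1) :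
    samePairs n a x y v w ≤ 2 * (n * n) := by
  unfold samePairs
  split_ifs
  · omega
  · have h1 := Nat.mul_le_mul (nbrsAbove_le (x := x) (y := y) w (ha v hv))
      (nbrsAbove_le (x := x) (y := y) v (ha w hw))
    have h2 := Nat.mul_le_mul (nbrsBelow_le (x := x) (y := y) w (ha v hv))
      (nbrsBelow_le (x := x) (y := y) v (ha w hw))
    omega

theorem oppositePairs_le {v w : ℕ} (hv : v < n) (hw : w < n) (ha : ∀ v < n, ∀ u < n, a v u ≤ 1) :
    oppositePairs n a x y v w ≤ 2 * (n * n) := by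
  unfold oppositePairs
  split_ifs
  · omega
  · have h1 := Nat.mul_le_mul (nbrsAbove_le (x := x) (y := y) w (ha v hv))
      (nbrsBelow_le (x := x) (y := y) v (ha w hw))
    have h2 := Nat.mul_le_mul (nbrsBelow_le (x := x) (y := y) w (ha v hv))
      (nbrsAbove_le (x := x) (y := y) v (ha w hw))
    omega

/-- The state stores the numbers of neighbours above and below each line. -/
def HoldsCounts (n : ℕ) (a : ℕ → ℕ → ℕ) (x y : ℕ → ℝ) (m : ℕ) (s : State) : Prop :=
  ∀ v < m, ∀ w < n, w ≠ v → s.wmem 4 (v * n + w) = nbrsAbove n a x y v w ∧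
    s.wmem 5 (v * n + w) = nbrsBelow n a x y v w

theorem pairBody_spec {v w P N : ℕ} (h0 : s.wreg 0 = n) (h1 : s.wreg 1 = v) (h2 : s.wreg 2 = w)
    (hv : v < n) (hw : w < n) (h7 : s.wreg 7 = P) (h8 : s.wreg 8 = N)
    (hc : HoldsCounts n a x y n s) (ha : ∀ v < n, ∀ u < n, a v u ≤ 1)
    (hP : P + 2 * (n * n) < W) (hN : N + 2 * (n * n) < W) :
    WP W pairBody (fun t s' => t ≤ 17 ∧ s'.wreg 7 = P + samePairs n a x y v w ∧
      s'.wreg 8 = N + oppositePairs n a x y v w) s := by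
  refine .ite ?_ ?_
  · intro hb
    simp only [Test.Holds, h1, h2] at hb
    exact .skip ⟨by omega, by simp [samePairs, hb, h7], by simp [oppositePairs, hb, h8]⟩
  · intro hb
    simp only [Test.Holds, h1, h2] at hb
    obtain ⟨c1, c2⟩ := hc v hv w hw (Ne.symm hb)
    obtain ⟨c3, c4⟩ := hc w hw v hv hb
    have b1 := samePairs_le (x := x) (y := y) hv hw ha
    have b2 := oppositePairs_le (x := x) (y := y) hv hw ha
    have i1 := mul_add_lt_mul hv hw
    have i2 := mul_add_lt_mul hw hv
    have hn : n ≤ n * n := Nat.le_mul_self n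
    have l1 := nbrsAbove_le (x := x) (y := y) w (ha v hv)
    have l2 := nbrsBelow_le (x := x) (y := y) w (ha v hv)
    have l3 := nbrsAbove_le (x := x) (y := y) v (ha w hw)
    have l4 := nbrsBelow_le (x := x) (y := y) v (ha w hw)
    rw [samePairs, if_neg hb] at b1 ⊢
    rw [oppositePairs, if_neg hb] at b2 ⊢
    refine .block ?_ ⟨by simp, ?_, ?_⟩
    · simp [h0, h1, h2, h7, h8, c1, c2, c3, c4]
      omega
    · simp [h0, h1, h2, h7, c1, c2, c3, c4, add_assoc]
    · simp [h0, h1, h2, h8, c1, c2, c3, c4, add_assoc]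

theorem pairLoop_spec {v P N : ℕ} (hs : Holds n a x y s) (h1 : s.wreg 1 = v) (h2 : s.wreg 2 = 0)
    (hv : v < n) (h7 : s.wreg 7 = P) (h8 : s.wreg 8 = N)
    (hc : HoldsCounts n a x y n s) (ha : ∀ v < n, ∀ u < n, a v u ≤ 1)
    (hW : n * (n * (2 * (n * n))) + n < W)
    (hP : P ≤ v * (n * (2 * (n * n)))) (hN : N ≤ v * (n * (2 * (n * n)))) :
    WP W (forLoop 2 0 3 pairBody) (fun t s' => t ≤ n * 19 + 1 ∧
      s'.wreg 7 = P + ∑ w ∈ Finset.range n, samePairs n a x y v w ∧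
      s'.wreg 8 = N + ∑ w ∈ Finset.range n, oppositePairs n a x y v w) s := by
  have hvn : v * (n * (2 * (n * n))) + n * (2 * (n * n)) ≤ n * (n * (2 * (n * n))) := by
    rw [← Nat.succ_mul]; exact Nat.mul_le_mul_right _ hv
  have hb : ∀ (f : ℕ → ℕ) (k : ℕ), k < n → (∀ w < n, f w ≤ 2 * (n * n)) →
      ∑ w ∈ Finset.range k, f w + 2 * (n * n) ≤ n * (2 * (n * n)) := by
    intro f k hk hf
    have h := Finset.sum_le_card_nsmul (Finset.range k) f (2 * (n * n))
      fun w hw => hf w ((Finset.mem_range.mp hw).trans hk)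
    rw [Finset.card_range, smul_eq_mul] at h
    have : (k + 1) * (2 * (n * n)) ≤ n * (2 * (n * n)) := Nat.mul_le_mul_right _ hk
    rw [Nat.succ_mul] at this
    exact (Nat.add_le_add_right h _).trans this
  refine (WP.forLoop (N := n) (C := 17) (fun k s' =>
      s'.wreg 7 = P + ∑ w ∈ Finset.range k, samePairs n a x y v w ∧
      s'.wreg 8 = N + ∑ w ∈ Finset.range k, oppositePairs n a x y v w)
    h2 hs.size hs.one rfl rfl rfl (by decide) (by decide) (by omega) (by simp [h7, h8]) ?_).mono ?_
  · rintro k s' hk hf hi ⟨h7', h8'⟩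
    have b1 := hb _ k hk fun w hw => samePairs_le (x := x) (y := y) hv hw ha
    have b2 := hb _ k hk fun w hw => oppositePairs_le (x := x) (y := y) hv hw ha
    refine (pairBody_spec (x := x) (y := y) ((hf.wreg 0 rfl).trans hs.size) ((hf.wreg 1 rfl).trans h1) hi hv
      hk h7' h8' ?_ ha (by omega) (by omega)).mono ?_
    · unfold HoldsCounts
      rw [hf.wmem 4 rfl, hf.wmem 5 rfl]
      exact hc
    · rintro t s'' ⟨ht, e7, e8⟩
      refine ⟨ht, ?_, ?_⟩
      · simp [e7, Finset.sum_range_succ, add_assoc]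
      · simp [e8, Finset.sum_range_succ, add_assoc]
  · rintro t s' ⟨hf, ⟨h7', h8'⟩, hi, ht⟩
    exact ⟨ht, h7', h8'⟩

/-- An upper bound for the running time. -/
def timeBound (n : ℕ) : ℕ :=
  n * (Nat.clog 2 n * (n * 29 + 6) + n * 50 + 15) + n * (n * 19 + 4) + 8

/-- Here the coordinates are arbitrary; general position enters only through `htie`. Positive and
negative contributions are accumulated separately because words are natural numbers. That the final
subtractions and the division are exact is not needed here and follows from `sum_samePairs`. -/
theorem countCrossings_spec (h0 : s.wreg 0 = n) (h1 : s.wreg 1 = 0) (h6 : s.wreg 6 = 0)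
    (h7 : s.wreg 7 = 0) (h8 : s.wreg 8 = 0)
    (hadj : ∀ v < n, ∀ u < n, s.wmem 0 (v * n + u) = a v u)
    (hx : ∀ v < n, s.rmem 0 v = x v) (hy : ∀ v < n, s.rmem 1 v = y v)
    (ha : ∀ v < n, ∀ u < n, a v u ≤ 1)
    (htie : ∀ v < n, ∀ w < n, w ≠ v → ∀ u < n, u ≠ w →
      slopeKey x y v u = slopeKey x y v w → a v u = 0)
    (hW : n * (n * (2 * (n * n))) + n * (n * n) + n * n + 2 * n + 8 < W) :
    WP W countCrossings (fun t s' => t ≤ timeBound n ∧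
      s'.wreg 0 = (∑ v ∈ Finset.range n, ∑ w ∈ Finset.range n, samePairs n a x y v w -
        ∑ v ∈ Finset.range n, ∑ w ∈ Finset.range n, oppositePairs n a x y v w -
        ∑ v ∈ Finset.range n, degree n a v * (degree n a v - 1)) / 8) s := by
  have hok₁ : Oks W [.wconst 3 1] s := by simp; omega
  have hf₁ := effects_frame hok₁
  refine .seq (.block hok₁ (.seq ?_))
  have hs₁ : Holds n a x y (effects [.wconst 3 1] s) :=
    ⟨by simpa using h0, by simp, by simpa using hadj, by simpa using hx, by simpa using hy⟩
  have hdd : ∀ v < n, degree n a v * (degree n a v - 1) ≤ n * n := by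
    intro v hv
    have hdeg : degree n a v ≤ n :=
      sum_le_of_le_one subset_rfl fun u hu => ha v hv u (Finset.mem_range.mp hu)
    exact Nat.mul_le_mul hdeg (by omega)
  refine (WP.forLoop (N := n) (C := Nat.clog 2 n * (n * 29 + 6) + n * 50 + 13) (fun k s' =>
      s'.wreg 6 = ∑ v ∈ Finset.range k, degree n a v * (degree n a v - 1) ∧
      HoldsCounts n a x y k s') (by simpa using h1) hs₁.size hs₁.one rfl rfl rfl (by decide)
      (by decide) (by omega) ⟨by simpa using h6, by simp [HoldsCounts]⟩ ?_).mono ?_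
  · rintro k s' hk hf hi ⟨e6, hc⟩
    refine (vertexPhase_spec (hs₁.frame hf rfl rfl rfl rfl rfl) hi hk e6 ?_ (htie k hk) (ha k hk)
      (by omega)).mono ?_
    · have h := Finset.sum_le_card_nsmul (Finset.range k) _ (n * n)
        fun v hv => hdd v ((Finset.mem_range.mp hv).trans hk)
      rwa [Finset.card_range, smul_eq_mul] at h
    · rintro t s'' ⟨ht, e6', hC, hpre⟩
      refine ⟨ht, by simp [e6', Finset.sum_range_succ], ?_⟩
      intro v hv w hw hwv
      rcases Nat.lt_succ_iff_lt_or_eq.mp hv with hv | rfl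
      · have hlt : v * n + w < k * n := by
          have : (v + 1) * n ≤ k * n := Nat.mul_le_mul_right _ hv
          rw [Nat.succ_mul] at this
          omega
        simpa only [putWord_wmem, (hpre _ hlt).1, (hpre _ hlt).2] using hc v hv w hw hwv
      · exact hC w hw hwv
  rintro t₂ s₂ ⟨hf₂, ⟨e6, hc⟩, -, ht₂⟩
  have hs₂ := hs₁.frame hf₂ rfl rfl rfl rfl rfl
  have hok₃ : Oks W [.wconst 1 0] s₂ := by simp; omega
  have hf₃ := effects_frame hok₃
  refine .seq (.block hok₃ (.seq ?_))
  have hs₃ := hs₂.frame hf₃ rfl rfl rfl rfl rfl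
  have e7 : (effects [.wconst 1 0] s₂).wreg 7 = 0 := by
    rw [hf₃.wreg 7 rfl, hf₂.wreg 7 rfl, hf₁.wreg 7 rfl, h7]
  have e8 : (effects [.wconst 1 0] s₂).wreg 8 = 0 := by
    rw [hf₃.wreg 8 rfl, hf₂.wreg 8 rfl, hf₁.wreg 8 rfl, h8]
  have hbound : ∀ (f : ℕ → ℕ → ℕ) (k : ℕ), k ≤ n → (∀ v < n, ∀ w < n, f v w ≤ 2 * (n * n)) →
      ∑ v ∈ Finset.range k, ∑ w ∈ Finset.range n, f v w ≤ k * (n * (2 * (n * n))) := by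
    intro f k hk hf
    have h := Finset.sum_le_card_nsmul (Finset.range k) (fun v => ∑ w ∈ Finset.range n, f v w)
      (n * (2 * (n * n))) fun v hv => by
        have h := Finset.sum_le_card_nsmul (Finset.range n) (f v) (2 * (n * n))
          fun w hw => hf v ((Finset.mem_range.mp hv).trans_le hk) w (Finset.mem_range.mp hw)
        rwa [Finset.card_range, smul_eq_mul] at h
    rwa [Finset.card_range, smul_eq_mul] at h
  refine (WP.forLoop (N := n) (C := n * 19 + 2) (fun k s' =>
      s'.wreg 7 = ∑ v ∈ Finset.range k, ∑ w ∈ Finset.range n, samePairs n a x y v w ∧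
      s'.wreg 8 = ∑ v ∈ Finset.range k, ∑ w ∈ Finset.range n, oppositePairs n a x y v w)
    (by simp) hs₃.size hs₃.one rfl rfl rfl (by decide)
    (by decide) (by omega) ⟨by simpa using e7, by simpa using e8⟩ ?_).mono ?_
  · rintro k s' hk hf hi ⟨i7, i8⟩
    have hok : Oks W [.wconst 2 0] s' := by simp; omega
    have hf' := effects_frame hok
    refine .seq (.block hok ?_)
    refine (pairLoop_spec (v := k) ((hs₃.frame hf rfl rfl rfl rfl rfl).frame hf' rfl rfl rfl rfl rfl)
      (by simpa using hi) (by simp) hk (by simpa using i7) (by simpa using i8) ?_ ha (by omega)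
      (hbound _ k hk.le fun v hv w hw => samePairs_le hv hw ha)
      (hbound _ k hk.le fun v hv w hw => oppositePairs_le hv hw ha)).mono ?_
    · unfold HoldsCounts
      rw [hf'.wmem 4 rfl, hf'.wmem 5 rfl, hf.wmem 4 rfl, hf.wmem 5 rfl, hf₃.wmem 4 rfl,
        hf₃.wmem 5 rfl]
      exact hc
    · rintro t s'' ⟨ht, j7, j8⟩
      refine ⟨?_, ?_, ?_⟩
      · simp only [List.length]; omega
      · simp [j7, Finset.sum_range_succ]
      · simp [j8, Finset.sum_range_succ]
  rintro t₄ s₄ ⟨hf₄, ⟨j7, j8⟩, -, ht₄⟩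
  have j6 : s₄.wreg 6 = ∑ v ∈ Finset.range n, degree n a v * (degree n a v - 1) := by
    rw [hf₄.wreg 6 rfl, hf₃.wreg 6 rfl, e6]
  have hP : s₄.wreg 7 ≤ n * (n * (2 * (n * n))) := by
    rw [j7]
    exact hbound _ n le_rfl fun v hv w hw => samePairs_le hv hw ha
  refine .block ?_ ⟨?_, ?_⟩
  · simp
    omega
  · simp only [List.length, timeBound]
    have e1 : n * (Nat.clog 2 n * (n * 29 + 6) + n * 50 + 13 + 2) =
      n * (Nat.clog 2 n * (n * 29 + 6) + n * 50 + 15) := by ring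
    have e2 : n * (n * 19 + 2 + 2) = n * (n * 19 + 4) := by ring
    omega
  · simp [j6, j7, j8]

end RealRAM

namespace RealRAM

/-! ### The geometry of slope keys. -/

/-- In the right half plane, the order of the pseudo-angles `y / (x + |y|)` is the order of the
slopes. -/
theorem div_add_abs_lt_iff {x₁ y₁ x₂ y₂ : ℝ} (hx₁ : 0 ≤ x₁) (hy₁ : x₁ = 0 → 0 < y₁)
    (hx₂ : 0 ≤ x₂) (hy₂ : x₂ = 0 → 0 < y₂) :
    y₁ / (x₁ + |y₁|) < y₂ / (x₂ + |y₂|) ↔ 0 < x₁ * y₂ - y₁ * x₂ := by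
  have hd : ∀ {x y : ℝ}, 0 ≤ x → (x = 0 → 0 < y) → 0 < x + |y| := by
    intro x y hx hy
    rcases hx.lt_or_eq with h | h
    · exact add_pos_of_pos_of_nonneg h (abs_nonneg y)
    · exact add_pos_of_nonneg_of_pos hx (abs_pos.mpr (hy h.symm).ne')
  rw [div_lt_div_iff₀ (hd hx₁ hy₁) (hd hx₂ hy₂)]
  -- If the ordinates have the same sign, the products with absolute values on the two sides are
  -- equal and cancel. If the signs differ, they decide both inequalities.
  rcases le_or_gt 0 y₁ with h1 | h1 <;> rcases le_or_gt 0 y₂ with h2 | h2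
  · rw [abs_of_nonneg h1, abs_of_nonneg h2]
    constructor <;> intro h <;> linarith
  · rw [abs_of_nonneg h1, abs_of_neg h2]
    have hx₂' : 0 < x₂ := lt_of_le_of_ne hx₂ fun h => absurd (hy₂ h.symm) h2.not_gt
    have m1 := mul_nonneg h1 hx₂
    have m2 := mul_nonneg hx₁ (neg_nonneg.mpr h2.le)
    have m3 := mul_nonneg h1 (neg_nonneg.mpr h2.le)
    constructor <;> intro h <;> nlinarith
  · rw [abs_of_neg h1, abs_of_nonneg h2]
    have hx₁' : 0 < x₁ := lt_of_le_of_ne hx₁ fun h => absurd (hy₁ h.symm) h1.not_gt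
    have m0 : 0 < -y₁ * x₂ + x₁ * y₂ := by
      rcases hx₂.lt_or_eq with h | h
      · have := mul_pos (neg_pos.mpr h1) h
        have := mul_nonneg hx₁ h2
        linarith
      · rw [← h]
        have := mul_pos hx₁' (hy₂ h.symm)
        linarith
    have m3 := mul_nonneg (neg_nonneg.mpr h1.le) h2
    constructor <;> intro h <;> nlinarith
  · rw [abs_of_neg h1, abs_of_neg h2]
    constructor <;> intro h <;> linarith

/-- The sign of the reflection of the vector from `v` to `u` into the right half plane. -/
noncomputable def reflSign (x y : ℕ → ℝ) (v u : ℕ) : ℤ := 2 * lexBit x y v u - 1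

theorem lexBit_cases (x y : ℕ → ℝ) (v u : ℕ) :
    (lexBit x y v u = 0 ∧ reflSign x y v u = -1) ∨ (lexBit x y v u = 1 ∧ reflSign x y v u = 1) := by
  have := lexBit_le_one x y v u
  rcases Nat.le_one_iff_eq_zero_or_eq_one.mp this with h | h <;> simp [reflSign, h]

/-- The determinant is bilinear and each reflection multiplies a vector by 1 or -1. -/
theorem refl_cross (x y : ℕ → ℝ) (v w u : ℕ) :
    reflX x y v w * reflY x y v u - reflY x y v w * reflX x y v u =
      (reflSign x y v w * reflSign x y v u : ℤ) *
        ((x w - x v) * (y u - y v) - (y w - y v) * (x u - x v)) := by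
  rcases lexBit_cases x y v w with ⟨h1, h2⟩ | ⟨h1, h2⟩ <;>
  rcases lexBit_cases x y v u with ⟨h3, h4⟩ | ⟨h3, h4⟩ <;>
  simp [reflX, reflY, h1, h2, h3, h4] <;> ring

theorem refl_mem_half_plane {x y : ℕ → ℝ} {v u : ℕ} (h : x u ≠ x v ∨ y u ≠ y v) :
    0 ≤ reflX x y v u ∧ (reflX x y v u = 0 → 0 < reflY x y v u) := by
  unfold reflX reflY lexBit
  by_cases hb : x u - x v < 0 ∨ (x u - x v = 0 ∧ y u - y v < 0)
  · rw [if_pos hb]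
    simp only [if_true]
    rcases hb with hb | ⟨hb, hb'⟩
    · exact ⟨by linarith, fun h => by linarith⟩
    · exact ⟨by linarith, fun h => by linarith⟩
  · rw [if_neg hb]
    simp only [one_ne_zero, if_false]
    push Not at hb
    refine ⟨hb.1, fun h0 => lt_of_le_of_ne (hb.2 h0) fun h1 => ?_⟩
    rcases h with h | h
    · exact h (sub_eq_zero.mp h0)
    · exact h (sub_eq_zero.mp h1.symm)

/-- Of two distinct points exactly one comes first lexicographically. Hence `reflSign` is an
admissible choice of `ε` in `sum_signed_counts`: it directs every line from left to right, vertical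
ones upwards. -/
theorem reflSign_mul_reflSign {x y : ℕ → ℝ} {v u : ℕ} (h : x u ≠ x v ∨ y u ≠ y v) :
    reflSign x y v u * reflSign x y u v = -1 := by
  have key : lexBit x y v u + lexBit x y u v = 1 := by
    unfold lexBit
    rcases lt_trichotomy (x u) (x v) with h1 | h1 | h1
    · rw [if_pos (.inl (by linarith)), if_neg]
      rintro (h2 | ⟨h2, -⟩) <;> linarith
    · rcases lt_trichotomy (y u) (y v) with h2 | h2 | h2
      · rw [if_pos (.inr ⟨by linarith, by linarith⟩), if_neg]
        rintro (h3 | ⟨-, h3⟩) <;> linarith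
      · exact absurd h2 (h.resolve_left (not_not.mpr h1))
      · rw [if_neg, if_pos (.inr ⟨by linarith, by linarith⟩)]
        rintro (h3 | ⟨-, h3⟩) <;> linarith
    · rw [if_neg, if_pos (.inl (by linarith))]
      rintro (h2 | ⟨h2, -⟩) <;> linarith
  rcases lexBit_cases x y v u with ⟨h1, h2⟩ | ⟨h1, h2⟩ <;>
  rcases lexBit_cases x y u v with ⟨h3, h4⟩ | ⟨h3, h4⟩ <;> simp_all

/-! ### From the input arrays to the number of crossings. -/

variable {n : ℕ}

/-- The adjacency matrix in the input. -/
noncomputable def inputAdj (G : GeometricGraph n) (v u : ℕ) : ℕ := (input G).wmem 0 (v * n + u)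

/-- The coordinates in the input. -/
noncomputable def inputCoord (G : GeometricGraph n) (k v : ℕ) : ℝ := (input G).rmem k v

theorem inputAdj_le_one (G : GeometricGraph n) (v u : ℕ) : inputAdj G v u ≤ 1 := by
  simp only [inputAdj, input]
  split_ifs <;> simp

theorem cast_inputAdj (G : GeometricGraph n) (v u : Fin n) : (inputAdj G v u : ℤ) = G.adjInt v u := by
  have key : (∃ i j : Fin n, (v : ℕ) * n + u = (i : ℕ) * n + (j : ℕ) ∧ G.graph.Adj i j) ↔
      G.graph.Adj v u := by
    constructor
    · rintro ⟨i, j, h, hij⟩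
      have hn : 0 < n := v.pos
      have e1 : v = i := by
        have := congrArg (· / n) h
        simp only [mul_comm _ n, Nat.mul_add_div hn, Nat.div_eq_of_lt u.2,
          Nat.div_eq_of_lt j.2] at this
        exact Fin.ext this
      have e2 : u = j := by
        rw [e1] at h
        exact Fin.ext (by omega)
      rwa [e1, e2]
    · exact fun h => ⟨v, u, rfl, h⟩
  simp only [inputAdj, input, GeometricGraph.adjInt]
  by_cases h : G.graph.Adj v u
  · rw [if_pos ⟨rfl, key.mpr h⟩, if_pos h, Nat.cast_one]
  · rw [if_neg fun hc => h (key.mp hc.2), if_neg h, Nat.cast_zero]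

theorem inputCoord_zero (G : GeometricGraph n) (v : Fin n) : inputCoord G 0 v = G.point v 0 := by
  simp [inputCoord, input]

theorem inputCoord_one (G : GeometricGraph n) (v : Fin n) : inputCoord G 1 v = G.point v 1 := by
  simp [inputCoord, input]

theorem inputCoord_ne (G : GeometricGraph n) {v u : Fin n} (h : v ≠ u) :
    inputCoord G 0 u ≠ inputCoord G 0 v ∨ inputCoord G 1 u ≠ inputCoord G 1 v := by
  by_contra! hc
  simp only [inputCoord_zero, inputCoord_one] at hc
  refine h (G.point_injective ?_)
  ext i
  fin_cases i
  · exact hc.1.symm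
  · exact hc.2.symm

theorem slopeKey_lt_iff (G : GeometricGraph n) {v w u : Fin n} (hw : v ≠ w) (hu : v ≠ u) :
    slopeKey (inputCoord G 0) (inputCoord G 1) v w < slopeKey (inputCoord G 0) (inputCoord G 1) v u ↔
      0 < (reflSign (inputCoord G 0) (inputCoord G 1) v w *
        reflSign (inputCoord G 0) (inputCoord G 1) v u : ℤ) * G.orient v w u := by
  obtain ⟨h1, h2⟩ := refl_mem_half_plane (inputCoord_ne G hw)
  obtain ⟨h3, h4⟩ := refl_mem_half_plane (inputCoord_ne G hu)
  unfold slopeKey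
  rw [div_add_abs_lt_iff h1 h2 h3 h4, refl_cross]
  simp only [inputCoord_zero, inputCoord_one, GeometricGraph.orient]

/-- Equal keys would make both strict comparisons fail, so by `slopeKey_lt_iff` the orientation of
the triple would be both nonnegative and nonpositive, against general position. -/
theorem slopeKey_ne (G : GeometricGraph n) {v w u : Fin n} (hw : v ≠ w) (hu : v ≠ u) (hwu : w ≠ u) :
    slopeKey (inputCoord G 0) (inputCoord G 1) v u ≠
      slopeKey (inputCoord G 0) (inputCoord G 1) v w := by
  intro h
  have h1 := (slopeKey_lt_iff G hw hu).not.mp h.not_gt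
  have h2 := (slopeKey_lt_iff G hu hw).not.mp h.not_lt
  have h3 := G.orient_ne_zero hw hu hwu
  rw [G.orient_swap_right v w u] at h2
  rcases lexBit_cases (inputCoord G 0) (inputCoord G 1) v w with ⟨-, e1⟩ | ⟨-, e1⟩ <;>
  rcases lexBit_cases (inputCoord G 0) (inputCoord G 1) v u with ⟨-, e2⟩ | ⟨-, e2⟩ <;>
  simp only [e1, e2] at h1 h2 <;> push_cast at h1 h2 <;>
  exact h3 (le_antisymm (by linarith) (by linarith))

/-- A neighbour u contributes `reflSign` of (v,u), times 1 or -1 according to whether its slope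
exceeds that of w. By `slopeKey_lt_iff` the second factor is the sign of the orientation times both
reflection signs. The sign of (v,u) occurs twice and cancels, and the term required by
`sum_signed_counts` is left. -/
theorem nbrsAbove_sub_nbrsBelow (G : GeometricGraph n) {v w : Fin n} (hw : v ≠ w) :
    (nbrsAbove n (inputAdj G) (inputCoord G 0) (inputCoord G 1) v w : ℤ) -
      nbrsBelow n (inputAdj G) (inputCoord G 0) (inputCoord G 1) v w =
    ∑ u, G.adjInt v u * (reflSign (inputCoord G 0) (inputCoord G 1) v w * G.orientSign v w u) := by
  classical
  unfold nbrsAbove nbrsBelow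
  rw [Finset.sum_range, Finset.sum_range]
  push_cast
  rw [← Finset.sum_sub_distrib]
  refine Finset.sum_congr rfl fun u _ => ?_
  have hsum := nbrPos_add_nbrNeg (inputAdj G) (inputCoord G 0) (inputCoord G 1) v u
  by_cases huw : u = w
  · subst huw
    simp [GeometricGraph.orientSign]
  have huw' : (u : ℕ) ≠ w := fun h => huw (Fin.ext h)
  by_cases hu : v = u
  · subst hu
    have : inputAdj G v v = 0 := by
      have := cast_inputAdj G v v
      simpa [GeometricGraph.adjInt] using this
    rw [this] at hsum
    simp [show nbrPos (inputAdj G) (inputCoord G 0) (inputCoord G 1) v v = 0 by omega,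
      show nbrNeg (inputAdj G) (inputCoord G 0) (inputCoord G 1) v v = 0 by omega,
      GeometricGraph.orientSign]
  have hdiff : (nbrPos (inputAdj G) (inputCoord G 0) (inputCoord G 1) v u : ℤ) -
      nbrNeg (inputAdj G) (inputCoord G 0) (inputCoord G 1) v u =
      G.adjInt v u * reflSign (inputCoord G 0) (inputCoord G 1) v u := by
    rw [← cast_inputAdj]
    have e : nbrPos (inputAdj G) (inputCoord G 0) (inputCoord G 1) v u =
      inputAdj G v u * lexBit (inputCoord G 0) (inputCoord G 1) v u := rfl
    rw [reflSign]
    zify at e hsum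
    linear_combination 2 * e - hsum
  have h3 := G.orient_ne_zero hw hu (Ne.symm huw)
  rw [if_neg huw', if_neg huw', if_congr (slopeKey_lt_iff G hw hu) rfl rfl,
    if_congr (slopeKey_lt_iff G hw hu) rfl rfl]
  unfold GeometricGraph.orientSign
  rcases lexBit_cases (inputCoord G 0) (inputCoord G 1) v w with ⟨-, e1⟩ | ⟨-, e1⟩ <;>
  rcases lexBit_cases (inputCoord G 0) (inputCoord G 1) v u with ⟨-, e2⟩ | ⟨-, e2⟩ <;>
  rw [e2] at hdiff <;> rcases lt_or_gt_of_ne h3 with h | h <;>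
  simp [e1, e2, h, h.not_gt] <;> linarith

/-- For each pair of vertices, same-side minus opposite-side pairs factor as the product of the two
signed counts, so `sum_signed_counts` applies. The additive form in natural numbers shows that the
truncated subtractions of the program are exact. -/
theorem sum_samePairs (G : GeometricGraph n) :
    ∑ v ∈ Finset.range n, ∑ w ∈ Finset.range n,
        samePairs n (inputAdj G) (inputCoord G 0) (inputCoord G 1) v w =
      ∑ v ∈ Finset.range n, ∑ w ∈ Finset.range n,
        oppositePairs n (inputAdj G) (inputCoord G 0) (inputCoord G 1) v w +
      (∑ v ∈ Finset.range n, degree n (inputAdj G) v * (degree n (inputAdj G) v - 1) +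
        8 * G.crossings) := by
  have hdeg : ∀ v : Fin n, ((degree n (inputAdj G) v * (degree n (inputAdj G) v - 1) : ℕ) : ℤ) =
      (∑ u, G.adjInt v u) * ((∑ u, G.adjInt v u) - 1) := by
    intro v
    have : (degree n (inputAdj G) v : ℤ) = ∑ u, G.adjInt v u := by
      rw [degree, Finset.sum_range]
      push_cast
      exact Finset.sum_congr rfl fun u _ => cast_inputAdj G v u
    rw [← this]
    -- At degree 0 the truncated predecessor is 0 instead of -1, but it is multiplied by 0.
    cases degree n (inputAdj G) v <;> simp
  have h := G.sum_signed_counts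
    (fun v w => reflSign (inputCoord G 0) (inputCoord G 1) v w)
    (fun v w => (nbrsAbove n (inputAdj G) (inputCoord G 0) (inputCoord G 1) v w : ℤ) -
      nbrsBelow n (inputAdj G) (inputCoord G 0) (inputCoord G 1) v w)
    (fun v w hvw => reflSign_mul_reflSign (inputCoord_ne G hvw))
    (fun v w hvw => nbrsAbove_sub_nbrsBelow G hvw)
  have hpair : ∀ v w : Fin n,
      (samePairs n (inputAdj G) (inputCoord G 0) (inputCoord G 1) v w : ℤ) =
      oppositePairs n (inputAdj G) (inputCoord G 0) (inputCoord G 1) v w +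
      if v = w then 0 else
        ((nbrsAbove n (inputAdj G) (inputCoord G 0) (inputCoord G 1) v w : ℤ) -
          nbrsBelow n (inputAdj G) (inputCoord G 0) (inputCoord G 1) v w) *
        (nbrsAbove n (inputAdj G) (inputCoord G 0) (inputCoord G 1) w v -
          nbrsBelow n (inputAdj G) (inputCoord G 0) (inputCoord G 1) w v) := by
    intro v w
    unfold samePairs oppositePairs
    simp only [Fin.val_inj]
    split_ifs
    · simp
    · push_cast; ring
  simp only [Finset.sum_range]
  zify
  simp only [hpair, Finset.sum_add_distrib, h]
  have hS := Finset.sum_congr (s₁ := Finset.univ) rfl fun v _ => hdeg v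
  push_cast at hS
  linarith

/-! ### Asymptotics of the running time. -/

/-- Rounding up costs at most 1, which is at most log n for n ≥ 3; the base-two logarithm is at most
2 log n because log 2 exceeds 1/2. -/
theorem clog_le_log {n : ℕ} (hn : 3 ≤ n) : (Nat.clog 2 n : ℝ) ≤ 3 * Real.log n := by
  have hn0 : (0 : ℝ) < n := by positivity
  have h1 : 1 ≤ Real.log n := by
    rw [Real.le_log_iff_exp_le hn0]
    have : (3 : ℝ) ≤ n := by exact_mod_cast hn
    linarith [Real.exp_one_lt_d9]
  have h2 : Nat.clog 2 n ≤ Nat.log 2 n + 1 := by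
    refine Nat.clog_le_of_le_pow ?_
    exact (Nat.lt_pow_succ_log_self (by norm_num) n).le
  have h3 : (Nat.log 2 n : ℝ) * Real.log 2 ≤ Real.log n := by
    rw [← Real.log_pow]
    refine Real.log_le_log (by positivity) ?_
    exact_mod_cast Nat.pow_log_le_self 2 (by omega)
  have h4 : (Nat.clog 2 n : ℝ) ≤ Nat.log 2 n + 1 := by exact_mod_cast h2
  have h5 : (Nat.log 2 n : ℝ) * 0.5 ≤ Nat.log 2 n * Real.log 2 :=
    mul_le_mul_of_nonneg_left (by linarith [Real.log_two_gt_d9]) (by positivity)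
  linarith

theorem timeBound_isBigO :
    (fun n : ℕ => (timeBound n : ℝ)) =O[atTop] fun n : ℕ => (n : ℝ) ^ 2 * Real.log (n : ℝ) := by
  -- The constant is 35 * 3 + 96, from the bound `hT` below and the factor 3 of `clog_le_log`.
  refine IsBigO.of_bound 201 ?_
  filter_upwards [eventually_ge_atTop 3] with n hn
  have hlog : 1 ≤ Real.log n := by
    rw [Real.le_log_iff_exp_le (by positivity)]
    have : (3 : ℝ) ≤ n := by exact_mod_cast hn
    linarith [Real.exp_one_lt_d9]
  have hT : timeBound n ≤ n ^ 2 * (35 * Nat.clog 2 n + 96) := by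
    unfold timeBound
    generalize Nat.clog 2 n = c
    have h1 : 1 ≤ n := by omega
    have h2 : n * 1 ≤ n * n := Nat.mul_le_mul_left n h1
    have h3 : n * 1 * c ≤ n * n * c := Nat.mul_le_mul_right c h2
    nlinarith
  rw [Real.norm_of_nonneg (by positivity), Real.norm_of_nonneg (by positivity)]
  calc (timeBound n : ℝ) ≤ (n : ℝ) ^ 2 * (35 * Nat.clog 2 n + 96) := by exact_mod_cast hT
    _ ≤ (n : ℝ) ^ 2 * (201 * Real.log n) := by
      refine mul_le_mul_of_nonneg_left ?_ (by positivity)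
      linarith [clog_le_log hn]
    _ = 201 * ((n : ℝ) ^ 2 * Real.log n) := by ring

end RealRAM

/-- There is one real RAM program that, for every `n` and every geometric graph `G` on `n` vertices,
halts with the number of crossings of `G` in word register `0`, in `O(n ^ 2 * log n)` time, using
words of `O(log n)` bits. -/
theorem mainTheorem1 :
    ∃ (p : RealRAM.Program) (c : ℕ) (T : ℕ → ℕ),
      ((fun n : ℕ => (T n : ℝ)) =O[atTop] fun n : ℕ => (n : ℝ) ^ 2 * Real.log (n : ℝ)) ∧
      ∀ (n : ℕ) (G : GeometricGraph n), ∃ (t : ℕ) (s : RealRAM.State),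
        RealRAM.Runs ((n + 2) ^ c) p (RealRAM.input G) t s ∧
        t ≤ T n ∧
        s.wreg 0 = G.crossings := by
  refine ⟨RealRAM.countCrossings, 6, RealRAM.timeBound, RealRAM.timeBound_isBigO, fun n G => ?_⟩
  have htie : ∀ v < n, ∀ w < n, w ≠ v → ∀ u < n, u ≠ w →
      RealRAM.slopeKey (RealRAM.inputCoord G 0) (RealRAM.inputCoord G 1) v u =
        RealRAM.slopeKey (RealRAM.inputCoord G 0) (RealRAM.inputCoord G 1) v w →
      RealRAM.inputAdj G v u = 0 := by
    intro v hv w hw hwv u hu huw hkey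
    -- The vertex v has key 0 at itself, which may coincide with the key of a horizontal line; this
    -- is harmless since v is not its own neighbour.
    by_cases huv : u = v
    · subst huv
      have := RealRAM.cast_inputAdj G ⟨u, hv⟩ ⟨u, hv⟩
      simpa [GeometricGraph.adjInt] using this
    · exact absurd hkey (RealRAM.slopeKey_ne G (v := ⟨v, hv⟩) (w := ⟨w, hw⟩) (u := ⟨u, hu⟩)
        (by simpa using Ne.symm hwv) (by simpa using Ne.symm huv) (by simpa using Ne.symm huw))
  -- The largest bound for an accumulated value is 2 n^4. The sixth power of n + 2 also covers the
  -- lower terms and the constants, down to n = 0, as the expansion has nonnegative remaining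
  -- coefficients.
  have hW : n * (n * (2 * (n * n))) + n * (n * n) + n * n + 2 * n + 8 < (n + 2) ^ 6 := by
    have h : (n + 2) ^ 6 = n * (n * (2 * (n * n))) + n * (n * n) + n * n + 2 * n + 8 +
        (n ^ 6 + 12 * n ^ 5 + 58 * n ^ 4 + 159 * n ^ 3 + 239 * n ^ 2 + 190 * n + 55) + 1 := by ring
    omega
  obtain ⟨t, s, hr, ht, hs⟩ := RealRAM.countCrossings_spec (n := n)
    (a := RealRAM.inputAdj G) (x := RealRAM.inputCoord G 0) (y := RealRAM.inputCoord G 1)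
    (s := RealRAM.input G) rfl rfl rfl rfl rfl
    (fun _ _ _ _ => rfl) (fun _ _ => rfl) (fun _ _ => rfl)
    (fun v _ u _ => RealRAM.inputAdj_le_one G v u) htie hW
  refine ⟨t, s, hr, ht, ?_⟩
  rw [hs, RealRAM.sum_samePairs, Nat.add_sub_cancel_left, Nat.add_sub_cancel_left,
    Nat.mul_div_cancel_left _ (by norm_num)]
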